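/- Let $K\supseteq\mathbb{Q}$ be a field and let $q,t,k\in K$ be algebraically independent over $\mathbb{Q}$. Let $s\in K$ be a square root of $q/t$, written $s=(q/t)^{1/2}$, and let $L\in K$ be non-zero. Let $\Lambda_K=K[p_1,p_2,\dots]$ be the ring of symmetric functions over $K$, where $p_n$ is the $n$-th power sum, graded by $\deg p_n=n$. Let $\Lambda_{K,n}$ be its part of degree $n$, and $\widehat\Lambda_K=\prod_{n\ge0}\Lambda_{K,n}$. Define operators $\eta_d$, $D_d$, $T_d$ on $\Lambda_K$ as the coefficients of $z^{-d}$ in the currents $$\eta(z)=\exp\Bigl(\sum_{n>0}\tfrac{1-t^{-n}}{n}p_nz^n\Bigr)\exp\Bigl(-\sum_{n>0}(1-q^n)\partial_{p_n}z^{-n}\Bigr),\qquad D(z)=\exp\Bigl(\sum_{n>0}(1-q^n)\partial_{p_n}z^{-n}\Bigr),$$ and in the bosonized current of the deformed Virasoro algebra $$T(z)=\exp\Bigl(\sum_{n>0}\tfrac{1-t^{-n}}{1+(q/t)^n}\tfrac{p_n}{n}s^{-n}z^n\Bigr)\exp\Bigl(-\sum_{n>0}(1-q^n)\partial_{p_n}s^nz^{-n}\Bigr)k+\exp\Bigl(-\sum_{n>0}\tfrac{1-t^{-n}}{1+(q/t)^n}\tfrac{p_n}{n}s^{n}z^n\Bigr)\exp\Bigl(\sum_{n>0}(1-q^n)\partial_{p_n}s^{-n}z^{-n}\Bigr)k^{-1}.$$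 For a partition $\lambda$ with conjugate $\lambda'$ let $n(\lambda)=\sum_i(i-1)\lambda_i$, let $J_\lambda=J_\lambda(q,t)$ be the integral form of the Macdonald symmetric function, let $\langle\cdot,\cdot\rangle$ be the Macdonald inner product $\langle p_\lambda,p_\mu\rangle=\delta_{\lambda\mu}z_\lambda\prod_i\frac{1-q^{\lambda_i}}{1-t^{\lambda_i}}$, where $z_\lambda=\prod_{i\ge1}i^{m_i}m_i!$ if $i$ occurs $m_i$ times in $\lambda$. Let $B_\lambda=\{q^{j-1}t^{1-i}\mid (i,j)\in\lambda\}$, and let $h_r[B_\lambda]$ be the coefficient of $u^r$ in $\prod_{b\in B_\lambda}(1-ub)^{-1}$ (so $h_{-1}:=0$). Let $\Delta_{h_r}$ be the linear operator on $\Lambda_K$ with $\Delta_{h_r}J_\lambda=h_r[B_\lambda]J_\lambda$ for all $\lambda$. Put $$v_n^{(r)}=\sum_{\lambda\vdash n}\frac{q^{n(\lambda')}}{\langle J_\lambda,J_\lambda\rangle}h_r[B_\lambda]\,J_\lambda,\qquad v_n(u)=\sum_{r\ge0}u^rv_n^{(r)}=\sum_{\lambda\vdash n}\frac{q^{n(\lambda')}}{\langle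 J_\lambda,J_\lambda\rangle}\prod_{b\in B_\lambda}\frac1{1-ub}\,J_\lambda,$$ with $u$ an indeterminate, $v_n^{(-1)}=0$ and $v_{-1}(u)=0$. Let $v_G=\sum_{n\ge0}L^nv_{G,n}\in\widehat\Lambda_K$ with $v_{G,n}=\bigl((q/t)^{1/2}k\bigr)^n\,v_n(k^2q/t)$. Then $v_n^{(r)}=\Delta_{h_r}v_n^{(0)}$ for all $n\ge0$ and all $r$, and the following four conditions are equivalent. 1. (Whittaker condition) $T_1v_G=Lv_G$, and $T_dv_G=0$ for all $d\ge2$. 2. For all $n\ge0$ and $d\ge1$, as formal power series in $u$, $$\bigl((q/t)^{d-1}u\,\eta_d+D_d\bigr)v_n(u)=\begin{cases}v_{n-1}(u)&(d=1)\\0&(d\ge2).\end{cases}$$ 3. For all $n\ge0$: $(u\eta_1+D_1)v_{n+1}(u)=v_n(u)$, and $(q/t)^{d-1}\eta_dv_n^{(r-1)}+D_dv_n^{(r)}=0$ for all $d\ge2$, $r\ge0$. 4. For all $n\ge0$: $(u\eta_1+D_1)v_{n+1}(u)=v_n(u)$; $D_dv_n^{(0)}=0$ for all $d\ge2$; and $\bigl((q/t)^{d-1}\eta_d\Delta_{h_{r-1}}+D_d\Delta_{h_r}\bigr)v_n^{(0)}=0$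 for all $d\ge2$, $r\ge0$. -/

import Mathlib

open MvPolynomial

noncomputable section

namespace Whittaker

/-! ### Fock space: symmetric functions as polynomials in the power sums `p_1, p_2, ...` -/

/-- The Fock space `Λ_K = K[p_1, p_2, ...]`; the variable `X n` is the power sum `p_n`. -/
abbrev Fock (K : Type*) [Field K] := MvPolynomial ℕ+ K

/-- The grading: `deg p_n = n`. -/
def deg : ℕ+ → ℕ := fun n => (n : ℕ)

/-- The degree `n` part `Λ_{K,n}`. -/
abbrev FockDeg (K : Type*) [Field K] (n : ℕ) : Submodule K (Fock K) :=
  weightedHomogeneousSubmodule K deg n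

/-- The completion `∏_n Λ_{K,n}` of the Fock space with respect to the grading. -/
abbrev FockHat (K : Type*) [Field K] := (n : ℕ) → FockDeg K n

/-- The linear operator on `Λ_K` which is equal to `F n` on `Λ_{K,n}`, for every `n`. -/
def ofGraded {K : Type*} [Field K] (F : ℕ → Module.End K (Fock K)) : Module.End K (Fock K) :=
  (basisMonomials ℕ+ K).constr K fun a => F (Finsupp.weight deg a) (monomial a 1)

theorem ofGraded_apply {K : Type*} [Field K] (F : ℕ → Module.End K (Fock K)) {n : ℕ}
    {f : Fock K} (hf : IsWeightedHomogeneous deg f n) : ofGraded F f = F n f := by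
  have hm : ∀ a : ℕ+ →₀ ℕ, ofGraded F (monomial a 1) = F (Finsupp.weight deg a) (monomial a 1) := by
    intro a
    have := (basisMonomials ℕ+ K).constr_basis K
      (fun a => F (Finsupp.weight deg a) (monomial a 1)) a
    simpa [ofGraded] using this
  have hs : ∀ a, (monomial a (coeff a f) : Fock K) = coeff a f • monomial a 1 := by
    intro a; simp [smul_monomial]
  rw [f.as_sum, map_sum, map_sum]
  refine Finset.sum_congr rfl fun a ha => ?_
  rw [hs a, map_smul, map_smul, hm a, hf (mem_support_iff.mp ha)]

/-! ### Vertex operators -/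

/-- `exp(A) = ∑_m A^m / m!` for a power series `A` without constant term; its coefficient of
degree `d` only involves `A^m` with `m ≤ d`. -/
def fexp (K : Type*) [Field K] {R : Type*} [Ring R] [Algebra K R] (A : PowerSeries R) :
    PowerSeries R :=
  PowerSeries.mk fun d =>
    ∑ m ∈ Finset.range (d + 1), ((m.factorial : K)⁻¹) • PowerSeries.coeff d (A ^ m)

/-- `exp(∑_{n>0} c_n p_n z^n)`, a power series in `z`. -/
def creation {K : Type*} [Field K] (c : ℕ → K) : PowerSeries (Fock K) :=
  fexp K (PowerSeries.mk fun n => if n = 0 then 0 else c n • (X n.toPNat' : Fock K))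

/-- `exp(∑_{n>0} c_n ∂/∂p_n z^{-n})`, a power series in `z^{-1}` with values in operators. -/
def annihilation {K : Type*} [Field K] (c : ℕ → K) : PowerSeries (Module.End K (Fock K)) :=
  fexp K (PowerSeries.mk fun n =>
    if n = 0 then 0 else c n • ((pderiv n.toPNat').toLinearMap : Module.End K (Fock K)))

/-- The mode of index `d`, that is the coefficient of `z^{-d}`, of
`exp(∑_{n>0} a_n p_n z^n) exp(∑_{n>0} b_n ∂/∂p_n z^{-n})`. It is the sum over `j` of the
coefficient of `z^{j-d}` of the first factor times the coefficient of `z^{-j}` of the second one;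
the latter lowers degrees by `j`, so that only `j ≤ n` contribute on `Λ_{K,n}`. -/
def vertexMode {K : Type*} [Field K] (a b : ℕ → K) (d : ℤ) : Module.End K (Fock K) :=
  ofGraded fun n => ∑ j ∈ Finset.range (n + 1),
    if d ≤ (j : ℤ) then
      LinearMap.mulLeft K (PowerSeries.coeff ((j : ℤ) - d).toNat (creation a)) *
        PowerSeries.coeff j (annihilation b)
    else 0

/-- The modes of
`η(z) = exp(∑_{n>0} (1-t^{-n})/n p_n z^n) exp(-∑_{n>0} (1-q^n) ∂/∂p_n z^{-n})
  = ∑_d η_d z^{-d}`. -/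
def eta {K : Type*} [Field K] (q t : K) (d : ℤ) : Module.End K (Fock K) :=
  vertexMode (fun n => (1 - (t ^ n)⁻¹) / n) (fun n => -(1 - q ^ n)) d

/-- The modes of `D(z) = exp(∑_{n>0} (1-q^n) ∂/∂p_n z^{-n}) = ∑_{d≥0} D_d z^{-d}`. -/
def Dop {K : Type*} [Field K] (q : K) (d : ℕ) : Module.End K (Fock K) :=
  PowerSeries.coeff d (annihilation fun n => 1 - q ^ n)

/-- The modes of the bosonized deformed Virasoro current `T(z) = ∑_d T_d z^{-d}`,
with `s` a square root of `q/t` and highest weight parameter `k`. -/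
def Tmode {K : Type*} [Field K] (q t s k : K) (d : ℤ) : Module.End K (Fock K) :=
  k • vertexMode (fun n => (1 - (t ^ n)⁻¹) / (1 + (q / t) ^ n) / n * (s ^ n)⁻¹)
      (fun n => -((1 - q ^ n) * s ^ n)) d
  + k⁻¹ • vertexMode (fun n => -((1 - (t ^ n)⁻¹) / (1 + (q / t) ^ n) / n * s ^ n))
      (fun n => (1 - q ^ n) * (s ^ n)⁻¹) d

/-- The action on the completed Fock space of an operator `A` which lowers degrees by `d`:
the degree `m` component of `A w` is `A w_{m+d}`. -/
def lower {K : Type*} [Field K] (A : Module.End K (Fock K)) (d : ℕ) (w : FockHat K) : FockHat K :=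
  fun m => ⟨weightedHomogeneousComponent deg m (A (w (m + d))),
    weightedHomogeneousComponent_mem deg _ m⟩

/-- `w` is a Whittaker vector: `T_1 w = L w` and `T_d w = 0` for `d ≥ 2`. -/
def IsWhittaker {K : Type*} [Field K] (q t s k L : K) (w : FockHat K) : Prop :=
  lower (Tmode q t s k 1) 1 w = L • w ∧
    ∀ d : ℕ, 2 ≤ d → lower (Tmode q t s k d) d w = 0

/-! ### Partitions -/

/-- The parts of a partition in non-increasing order. -/
def rows {n : ℕ} (lam : n.Partition) : List ℕ := lam.parts.sort (· ≥ ·)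

/-- The Young diagram of a partition; its boxes are `(i, j)` with `i, j ≥ 0`, so that
the usual coordinates of the box are `(i + 1, j + 1)`. -/
def diagram {n : ℕ} (lam : n.Partition) : YoungDiagram :=
  YoungDiagram.ofRowLens (rows lam) (lam.parts.pairwise_sort (· ≥ ·)).sortedGE

/-- The arm length `λ_i - j` of a box. -/
def arm (Y : YoungDiagram) (b : ℕ × ℕ) : ℕ := Y.rowLen b.1 - (b.2 + 1)

/-- The leg length `λ'_j - i` of a box. -/
def leg (Y : YoungDiagram) (b : ℕ × ℕ) : ℕ := Y.colLen b.2 - (b.1 + 1)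

/-- `n(λ) = ∑_i (i-1) λ_i`. -/
def nstat (Y : YoungDiagram) : ℕ := ∑ i ∈ Finset.range (Y.colLen 0), i * Y.rowLen i

/-- The letter `B_s = q^{j(s)-1} t^{1-i(s)}` of the alphabet `B_λ`. -/
def letter {K : Type*} [Field K] (q t : K) (b : ℕ × ℕ) : K := q ^ b.2 * (t ^ b.1)⁻¹

/-- `h_r[B_λ]`, the coefficient of `u^r` in `∏_{s∈λ} (1 - u B_s)^{-1}`; zero for `r < 0`. -/
def hB {K : Type*} [Field K] (q t : K) (Y : YoungDiagram) (r : ℤ) : K :=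
  if r < 0 then 0 else
    PowerSeries.coeff r.toNat
      (∏ b ∈ Y.cells, (1 - PowerSeries.C (letter q t b) * PowerSeries.X : PowerSeries K)⁻¹)

/-! ### Macdonald symmetric functions -/

/-- The power sum product `p_λ`. -/
def pPart (K : Type*) [Field K] {n : ℕ} (lam : n.Partition) : Fock K :=
  (lam.parts.map fun i => (X i.toPNat' : Fock K)).prod

/-- The matrix `R` with `p_μ = ∑_λ R_{μλ} m_λ`: the entry is the coefficient of
`x_1^{λ_1} x_2^{λ_2} ⋯` in `p_μ(x_1, ..., x_n)`. -/
def transition (K : Type*) [Field K] (n : ℕ) : Matrix n.Partition n.Partition K :=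
  fun mu lam =>
    coeff (Finsupp.equivFunOnFinite.symm fun i : Fin n => (rows lam).getD i 0)
      (mu.parts.map fun i => psum (Fin n) K i).prod

/-- The monomial symmetric function `m_λ`, expressed through power sums. -/
def mPart {K : Type*} [Field K] {n : ℕ} (lam : n.Partition) : Fock K :=
  ∑ mu : n.Partition, (transition K n)⁻¹ lam mu • pPart K mu

/-- The Macdonald inner product
`⟨p_λ, p_μ⟩ = δ_{λμ} z_λ ∏_i (1-q^{λ_i})/(1-t^{λ_i})`, where `z_λ = ∏_{i≥1} i^{m_i} m_i!`
if `i` occurs `m_i` times in `λ`. -/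
def ip {K : Type*} [Field K] (q t : K) (f g : Fock K) : K :=
  f.support.sum fun a => coeff a f * coeff a g *
    a.prod fun i m => ((i : ℕ) : K) ^ m * (m.factorial : K) *
      ((1 - q ^ (i : ℕ)) / (1 - t ^ (i : ℕ))) ^ m

/-- The partitions of `n` that are smaller than `lam` in the lexicographic order, a total order
which refines the dominance order. -/
def below {n : ℕ} (lam : n.Partition) : Finset n.Partition :=
  Finset.univ.filter fun mu => rows mu < rows lam

theorem below_card_lt {n : ℕ} {mu lam : n.Partition} (h : mu ∈ below lam) :
    (below mu).card < (below lam).card := by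
  have h' : rows mu < rows lam := (Finset.mem_filter.mp h).2
  refine Finset.card_lt_card (Finset.ssubset_iff_subset_ne.mpr ⟨fun nu hnu => ?_, fun e => ?_⟩)
  · exact Finset.mem_filter.mpr ⟨Finset.mem_univ _, (Finset.mem_filter.mp hnu).2.trans h'⟩
  · rw [← e] at h
    exact lt_irrefl _ (Finset.mem_filter.mp h).2

/-- The Macdonald symmetric function `P_λ(q,t)`: the Gram-Schmidt orthogonalization of the
monomial symmetric functions with respect to the Macdonald inner product. Thus
`P_λ = m_λ + (combination of the smaller m_μ)` and `⟨P_λ, P_μ⟩ = 0` for `λ ≠ μ`. -/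
def macP {K : Type*} [Field K] (q t : K) {n : ℕ} (lam : n.Partition) : Fock K :=
  mPart lam - ∑ mu ∈ (below lam).attach,
    (ip q t (mPart lam) (macP q t mu.1) / ip q t (macP q t mu.1) (macP q t mu.1)) •
      macP q t mu.1
termination_by (below lam).card
decreasing_by all_goals exact below_card_lt mu.2

/-- The integral form `J_λ = c_λ P_λ`, with
`c_λ = ∏_{s∈λ} (1 - q^{a(s)} t^{l(s)+1})`. -/
def macJ {K : Type*} [Field K] (q t : K) {n : ℕ} (lam : n.Partition) : Fock K :=
  (∏ b ∈ (diagram lam).cells,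
    (1 - q ^ arm (diagram lam) b * t ^ (leg (diagram lam) b + 1))) • macP q t lam

/-- The Macdonald operator `Δ_{h_r}`, with `Δ_{h_r} J_λ = h_r[B_λ] J_λ`. On `Λ_{K,n}` it is
expanded along the orthogonal basis `(J_λ)_{λ ⊢ n}`. -/
def DeltaH {K : Type*} [Field K] (q t : K) (r : ℤ) : Module.End K (Fock K) :=
  (basisMonomials ℕ+ K).constr K fun a =>
    ∑ lam : (Finsupp.weight deg a).Partition,
      (ip q t (monomial a 1) (macJ q t lam) / ip q t (macJ q t lam) (macJ q t lam) *
        hB q t (diagram lam) r) • macJ q t lam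

/-! ### The vectors `v_n^{(r)}`, `v_n(u)` and `v_G` -/

/-- The coefficient `q^{n(λ')} / ⟨J_λ, J_λ⟩`. -/
def vCoeff {K : Type*} [Field K] (q t : K) {n : ℕ} (lam : n.Partition) : K :=
  q ^ nstat (diagram lam).transpose / ip q t (macJ q t lam) (macJ q t lam)

/-- `v_n^{(r)} = ∑_{λ⊢n} J_λ q^{n(λ')} / ⟨J_λ, J_λ⟩ h_r[B_λ]`; zero for `r < 0`. -/
def v {K : Type*} [Field K] (q t : K) (n : ℕ) (r : ℤ) : Fock K :=
  ∑ lam : n.Partition, (vCoeff q t lam * hB q t (diagram lam) r) • macJ q t lam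

/-- `v_n(u) = ∑_{r≥0} u^r v_n^{(r)}`, a formal power series in `u`. -/
def vSeries {K : Type*} [Field K] (q t : K) (n : ℕ) : PowerSeries (Fock K) :=
  PowerSeries.mk fun r => v q t n r

/-- The value of `v_n(u)` at an element `u` of the field, through
`∑_r u^r h_r[B_λ] = ∏_{s∈λ} (1 - u B_s)^{-1}`. -/
def vAt {K : Type*} [Field K] (q t u : K) (n : ℕ) : Fock K :=
  ∑ lam : n.Partition,
    (vCoeff q t lam * ∏ b ∈ (diagram lam).cells, (1 - u * letter q t b)⁻¹) • macJ q t lam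

/-- Action of an operator on the coefficients of a formal power series in `u`. -/
def coeffwise {K : Type*} [Field K] (A : Module.End K (Fock K)) (f : PowerSeries (Fock K)) :
    PowerSeries (Fock K) :=
  PowerSeries.mk fun r => A (PowerSeries.coeff r f)

/-- `((q/t)^{d-1} u η_d + D_d) v_n(u)`, a formal power series in `u` (for `d ≥ 1`). -/
def uEtaD {K : Type*} [Field K] (q t : K) (d n : ℕ) : PowerSeries (Fock K) :=
  PowerSeries.X * coeffwise ((q / t) ^ (d - 1) • eta q t d) (vSeries q t n)
    + coeffwise (Dop q d) (vSeries q t n)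

theorem pPart_homogeneous (K : Type*) [Field K] {n : ℕ} (lam : n.Partition) :
    pPart K lam ∈ FockDeg K n := by
  have key : ∀ s : Multiset ℕ, (∀ i ∈ s, 0 < i) →
      IsWeightedHomogeneous deg (s.map fun i => (X i.toPNat' : Fock K)).prod s.sum := by
    intro s
    induction s using Multiset.induction_on with
    | empty => intro _; simpa using isWeightedHomogeneous_one K deg
    | cons a s ih =>
      intro h
      rw [Multiset.map_cons, Multiset.prod_cons, Multiset.sum_cons]
      refine IsWeightedHomogeneous.mul ?_ (ih fun i hi => h i (Multiset.mem_cons_of_mem hi))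
      have ha : deg a.toPNat' = a := by
        have := h a (Multiset.mem_cons_self a s)
        simp [deg, this]
      simpa [ha] using isWeightedHomogeneous_X K deg a.toPNat'
  have := key lam.parts fun i hi => lam.parts_pos hi
  rw [lam.parts_sum] at this
  exact this

theorem macP_homogeneous {K : Type*} [Field K] (q t : K) {n : ℕ} (lam : n.Partition) :
    macP q t lam ∈ FockDeg K n := by
  have main : ∀ (N : ℕ) (lam : n.Partition), (below lam).card < N →
      macP q t lam ∈ FockDeg K n := by
    intro N
    induction N with
    | zero => intro lam h; exact absurd h (Nat.not_lt_zero _)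
    | succ N ih =>
      intro lam h
      rw [macP]
      refine Submodule.sub_mem _ (Submodule.sum_mem _ fun mu _ =>
        Submodule.smul_mem _ _ (pPart_homogeneous K mu)) (Submodule.sum_mem _ fun mu _ =>
          Submodule.smul_mem _ _ (ih mu.1 ?_))
      have := below_card_lt mu.2
      omega
  exact main _ lam (Nat.lt_succ_self _)

theorem vAt_homogeneous {K : Type*} [Field K] (q t u : K) (n : ℕ) :
    vAt q t u n ∈ FockDeg K n :=
  Submodule.sum_mem _ fun lam _ => Submodule.smul_mem _ _
    (Submodule.smul_mem _ _ (macP_homogeneous q t lam))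

/-- `v_G = ∑_n L^n v_{G,n}` in the completed Fock space, with
`v_{G,n} = ((q/t)^{1/2} k)^n v_n(k^2 q/t)`. -/
def vG {K : Type*} [Field K] (q t s k L : K) : FockHat K := fun n =>
  ⟨(L ^ n * (s * k) ^ n) • vAt q t (k ^ 2 * q / t) n,
    Submodule.smul_mem _ _ (vAt_homogeneous q t _ n)⟩

end Whittaker

end

/-!
The four conditions are linked by two facts.

*Dressing.* Multiplying the deformed Virasoro current on the left by the creation current
`ψ(z) = exp(∑_{n>0} (1-t^{-n})/(1+(q/t)^n) p_n/n s^n z^n)` gives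
`ψ(z) T(z) = k η(z/s) + k⁻¹ D(sz)` (`sum_dressing_mul_Tmode`), because
`(s^{-n} + s^n)/(1 + s^{2n}) = s^{-n}` in the first summand and because the creation parts cancel
in the second one. In modes, `(ψT)_d = T_d + ∑_{m≥1} ψ_m T_{d+m}`, a triangular system in which
only the modes `T_e` with `e ≥ d` occur, and only those with `e ≤ n` act on degree `n`. Since the
Whittaker condition requires `T_d w = 0` for `d ≥ 2`, it is equivalent to the same equations for
`(ψT)_d` (`forall_eq_ite_iff_forall_sum_eq_ite`, `isWhittaker_iff_forall_eta_Dop`). After the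
normalization of `v_G` is removed, this is the condition on `v_n(u)` at the point
`u = k² q / t` (`isWhittaker_vG_iff`).

*Specialization.* Everything except `k` is defined over `ℚ(q,t)`: the Macdonald functions, their
norms, and the operators `η_d` and `D_d`. Coefficient by coefficient in the power sums, the
relation between the `v_n(u)` is thus a linear relation between the rational functions
`∏_{b∈λ} (1 - u B_b)^{-1}` with coefficients in `ℚ(q,t)[u]`; both its validity for formal `u` and
its validity at an element transcendental over `ℚ(q,t)` mean that the same numerator polynomial
vanishes (`sum_aeval_mul_eq_zero_iff`, `eta_Dop_vAt_iff`). The element `k² q / t` is transcendental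
over `ℚ(q,t)` since `q, t, k` are algebraically independent.

The other equivalences compare coefficients of powers of `u` and use
`v_n^{(r)} = Δ_{h_r} v_n^{(0)}`. This identity (`v_eq_DeltaH`) rests on the orthogonality of the
`J_λ`, hence on Gram–Schmidt never meeting a nonzero isotropic vector. Over `K` the Macdonald inner
product may well be isotropic, but the Macdonald functions have coefficients in `ℚ(q,t)`, where the
squared norm of a nonzero vector, evaluated at a generic rational point with `0 < q, t < 1`, is a
sum of squares with positive coefficients (`ip_self_ne_zero`).
-/

noncomputable section

namespace Whittaker

/-! ### Exponentials of power series without constant term -/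

section Exponential

variable {K : Type*} [Field K] {R : Type*} [Ring R] [Algebra K R]

/-- Membership of the coefficients of `A ^ m` in a filtration-like family that is compatible with
products. It is used both for gradings and, with a constant family, for fields of definition. -/
theorem coeff_pow_mem (G : ℕ → AddSubmonoid R) (h1 : 1 ∈ G 0)
    (hmul : ∀ i j x y, x ∈ G i → y ∈ G j → x * y ∈ G (i + j)) {A : PowerSeries R}
    (hA : ∀ d, PowerSeries.coeff d A ∈ G d) (m d : ℕ) : PowerSeries.coeff d (A ^ m) ∈ G d := by
  induction m generalizing d with
  | zero =>
    rw [pow_zero, PowerSeries.coeff_one]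
    split_ifs with h
    · exact h ▸ h1
    · exact zero_mem _
  | succ m ih =>
    rw [pow_succ, PowerSeries.coeff_mul]
    refine sum_mem fun x hx => ?_
    rw [← Finset.HasAntidiagonal.mem_antidiagonal.mp hx]
    exact hmul _ _ _ _ (ih _) (hA _)

theorem coeff_fexp_mem (G : ℕ → AddSubmonoid R) (h1 : 1 ∈ G 0)
    (hmul : ∀ i j x y, x ∈ G i → y ∈ G j → x * y ∈ G (i + j))
    (hsmul : ∀ (m i : ℕ) x, x ∈ G i → ((m.factorial : K)⁻¹) • x ∈ G i) {A : PowerSeries R}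
    (hA : ∀ d, PowerSeries.coeff d A ∈ G d) (d : ℕ) : PowerSeries.coeff d (fexp K A) ∈ G d := by
  rw [fexp, PowerSeries.coeff_mk]
  exact sum_mem fun m _ => hsmul _ _ _ (coeff_pow_mem G h1 hmul hA m d)

theorem coeff_pow_of_scaled {A B : PowerSeries R} {r : K}
    (h : ∀ d, PowerSeries.coeff d B = r ^ d • PowerSeries.coeff d A) (m d : ℕ) :
    PowerSeries.coeff d (B ^ m) = r ^ d • PowerSeries.coeff d (A ^ m) := by
  induction m generalizing d with
  | zero =>
    simp only [pow_zero, PowerSeries.coeff_one]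
    split_ifs with hd <;> simp [hd]
  | succ m ih =>
    rw [pow_succ, pow_succ, PowerSeries.coeff_mul, PowerSeries.coeff_mul, Finset.smul_sum]
    refine Finset.sum_congr rfl fun x hx => ?_
    rw [ih, h, smul_mul_smul_comm, ← pow_add, Finset.HasAntidiagonal.mem_antidiagonal.mp hx]

/-- Rescaling the variable commutes with the exponential. -/
theorem coeff_fexp_of_scaled {A B : PowerSeries R} {r : K}
    (h : ∀ d, PowerSeries.coeff d B = r ^ d • PowerSeries.coeff d A) (d : ℕ) :
    PowerSeries.coeff d (fexp K B) = r ^ d • PowerSeries.coeff d (fexp K A) := by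
  rw [fexp, fexp, PowerSeries.coeff_mk, PowerSeries.coeff_mk, Finset.smul_sum]
  refine Finset.sum_congr rfl fun m _ => ?_
  rw [coeff_pow_of_scaled h, smul_comm]

variable (K R) in
theorem fexp_zero : fexp K (0 : PowerSeries R) = 1 := by
  ext d
  rw [fexp, PowerSeries.coeff_mk, Finset.sum_eq_single 0]
  · simp
  · intro m _ hm
    rw [zero_pow hm, map_zero, smul_zero]
  · simp

end Exponential

section CommutativeExponential

variable {K : Type*} [Field K] {R : Type*} [CommRing R] [Algebra K R]

theorem coeff_pow_mul_pow_eq_zero {A B : PowerSeries R} (hA : PowerSeries.constantCoeff A = 0)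
    (hB : PowerSeries.constantCoeff B = 0) {i j d : ℕ} (h : d < i + j) :
    PowerSeries.coeff d (A ^ i * B ^ j) = 0 := by
  have h1 : (PowerSeries.X : PowerSeries R) ^ (i + j) ∣ A ^ i * B ^ j := by
    rw [pow_add]
    exact mul_dvd_mul (pow_dvd_pow_of_dvd (PowerSeries.X_dvd_iff.mpr hA) i)
      (pow_dvd_pow_of_dvd (PowerSeries.X_dvd_iff.mpr hB) j)
  exact PowerSeries.X_pow_dvd_iff.mp h1 d h

/-- The exponential may be truncated at any order that is at least the degree. -/
theorem coeff_fexp_eq_sum {A : PowerSeries R} (hA : PowerSeries.constantCoeff A = 0) {d N : ℕ}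
    (h : d ≤ N) : PowerSeries.coeff d (fexp K A) =
      PowerSeries.coeff d (∑ m ∈ Finset.range (N + 1), ((m.factorial : K)⁻¹) • A ^ m) := by
  rw [fexp, PowerSeries.coeff_mk, map_sum]
  simp only [PowerSeries.coeff_smul]
  refine Finset.sum_subset (Finset.range_subset_range.mpr (by omega)) fun m _ hm => ?_
  have := coeff_pow_mul_pow_eq_zero hA hA (i := m) (j := 0) (d := d)
    (by simp only [Finset.mem_range] at hm; omega)
  rw [pow_zero, mul_one] at this
  rw [this, smul_zero]

theorem fexp_add [CharZero K] {A B : PowerSeries R} (hA : PowerSeries.constantCoeff A = 0)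
    (hB : PowerSeries.constantCoeff B = 0) : fexp K (A + B) = fexp K A * fexp K B := by
  ext d
  have hAB : PowerSeries.constantCoeff (A + B) = 0 := by rw [map_add, hA, hB, add_zero]
  -- The terms of total exponent above `d` do not contribute in degree `d`, so that the square
  -- of pairs of exponents may be replaced by a triangle.
  have key : PowerSeries.coeff d (fexp K A * fexp K B) = PowerSeries.coeff d
      ((∑ m ∈ Finset.range (d + 1), ((m.factorial : K)⁻¹) • A ^ m) *
        ∑ m ∈ Finset.range (d + 1), ((m.factorial : K)⁻¹) • B ^ m) := by
    rw [PowerSeries.coeff_mul, PowerSeries.coeff_mul]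
    refine Finset.sum_congr rfl fun x hx => ?_
    have := Finset.HasAntidiagonal.mem_antidiagonal.mp hx
    rw [coeff_fexp_eq_sum hA (N := d) (by omega), coeff_fexp_eq_sum hB (N := d) (by omega)]
  rw [key, coeff_fexp_eq_sum hAB le_rfl, Finset.sum_mul_sum, ← Finset.sum_product', map_sum,
    map_sum]
  have tri : ∑ p ∈ Finset.range (d + 1) ×ˢ Finset.range (d + 1), PowerSeries.coeff d
      (((p.1.factorial : K)⁻¹) • A ^ p.1 * ((p.2.factorial : K)⁻¹) • B ^ p.2) =
      ∑ p ∈ (Finset.range (d + 1) ×ˢ Finset.range (d + 1)).filter (fun p => p.1 + p.2 < d + 1),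
        PowerSeries.coeff d
          (((p.1.factorial : K)⁻¹) • A ^ p.1 * ((p.2.factorial : K)⁻¹) • B ^ p.2) := by
    symm
    refine Finset.sum_filter_of_ne fun p _ hp => ?_
    by_contra hlt
    refine hp ?_
    rw [smul_mul_smul_comm, PowerSeries.coeff_smul,
      coeff_pow_mul_pow_eq_zero hA hB (by omega), smul_zero]
  have split : (Finset.range (d + 1) ×ˢ Finset.range (d + 1)).filter (fun p => p.1 + p.2 < d + 1) =
      (Finset.range (d + 1)).biUnion Finset.HasAntidiagonal.antidiagonal := by
    ext p
    simp only [Finset.mem_filter, Finset.mem_product, Finset.mem_range, Finset.mem_biUnion,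
      Finset.HasAntidiagonal.mem_antidiagonal]
    constructor
    · rintro ⟨-, h⟩
      exact ⟨_, h, rfl⟩
    · rintro ⟨a, h, rfl⟩
      omega
  rw [tri, split, Finset.sum_biUnion]
  · refine Finset.sum_congr rfl fun m _ => ?_
    rw [(Commute.all A B).add_pow', ← map_sum, Finset.smul_sum]
    congr 1
    refine Finset.sum_congr rfl fun p hp => ?_
    have hm := Finset.HasAntidiagonal.mem_antidiagonal.mp hp
    rw [smul_mul_smul_comm, ← Nat.cast_smul_eq_nsmul K, smul_smul]
    congr 1
    have hc : ((m.choose p.1 : ℕ) : K) * p.1.factorial * p.2.factorial = m.factorial := by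
      rw [← hm, Nat.choose_symm_add]
      exact_mod_cast Nat.add_choose_mul_factorial_mul_factorial p.1 p.2
    have h0 : ∀ i : ℕ, (i.factorial : K) ≠ 0 := fun i => Nat.cast_ne_zero.mpr i.factorial_ne_zero
    rw [← hc]
    have hc0 : ((m.choose p.1 : ℕ) : K) ≠ 0 := fun h => h0 m (by rw [← hc, h]; ring)
    have := h0 p.1
    have := h0 p.2
    field_simp
  · intro a _ b _ hab
    exact Finset.disjoint_left.mpr fun p h1 h2 => hab
      ((Finset.HasAntidiagonal.mem_antidiagonal.mp h1).symm.trans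
        (Finset.HasAntidiagonal.mem_antidiagonal.mp h2))

end CommutativeExponential

/-! ### Creation and annihilation parts of vertex operators -/

section VertexOperators

variable {K : Type*} [Field K]

theorem creation_add [CharZero K] (a b : ℕ → K) :
    creation (fun n => a n + b n) = creation a * creation b := by
  rw [creation, creation, creation, ← fexp_add (by simp) (by simp)]
  congr 1
  ext1 d
  rw [map_add, PowerSeries.coeff_mk, PowerSeries.coeff_mk, PowerSeries.coeff_mk]
  split_ifs with h
  · rw [add_zero]
  · rw [add_smul]

theorem creation_zero : creation (fun _ => (0 : K)) = 1 := by
  rw [creation, ← fexp_zero K]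
  congr 1
  ext1 d
  simp

/-- The value of a coefficient function at `0` does not matter. -/
theorem creation_congr {a b : ℕ → K} (h : ∀ n, 0 < n → a n = b n) : creation a = creation b := by
  rw [creation, creation]
  congr 2
  ext1 d
  split_ifs with hd
  · rfl
  · rw [h d (Nat.pos_of_ne_zero hd)]

theorem coeff_zero_creation (a : ℕ → K) : PowerSeries.coeff 0 (creation a) = 1 := by
  simp [creation, fexp]

theorem coeff_creation_scaled (c : ℕ → K) (r : K) (d : ℕ) :
    PowerSeries.coeff d (creation fun n => c n * r ^ n) =
      r ^ d • PowerSeries.coeff d (creation c) := by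
  refine coeff_fexp_of_scaled (fun n => ?_) d
  rw [PowerSeries.coeff_mk, PowerSeries.coeff_mk]
  split_ifs
  · rw [smul_zero]
  · rw [smul_smul, mul_comm]

theorem coeff_annihilation_scaled (c : ℕ → K) (r : K) (d : ℕ) :
    PowerSeries.coeff d (annihilation fun n => c n * r ^ n) =
      r ^ d • PowerSeries.coeff d (annihilation c) := by
  refine coeff_fexp_of_scaled (fun n => ?_) d
  rw [PowerSeries.coeff_mk, PowerSeries.coeff_mk]
  split_ifs
  · rw [smul_zero]
  · rw [smul_smul, mul_comm]

/-- The operators on `Λ_K` that lower the degree by `j`; they vanish in degrees below `j`. -/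
def lowering (K : Type*) [Field K] (j : ℕ) : AddSubmonoid (Module.End K (Fock K)) where
  carrier := {A | ∀ n, ∀ f ∈ FockDeg K n, (n < j → A f = 0) ∧ (j ≤ n → A f ∈ FockDeg K (n - j))}
  zero_mem' := fun _ _ _ => ⟨fun _ => rfl, fun _ => zero_mem _⟩
  add_mem' := by
    intro A B hA hB n f hf
    refine ⟨fun h => ?_, fun h => add_mem ((hA n f hf).2 h) ((hB n f hf).2 h)⟩
    rw [LinearMap.add_apply, (hA n f hf).1 h, (hB n f hf).1 h, add_zero]

theorem mul_mem_lowering (i j : ℕ) (A B : Module.End K (Fock K)) (hA : A ∈ lowering K i)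
    (hB : B ∈ lowering K j) : A * B ∈ lowering K (i + j) := by
  intro n f hf
  rw [Module.End.mul_apply]
  constructor
  · intro h
    rcases lt_or_ge n j with hj | hj
    · rw [(hB n f hf).1 hj, map_zero]
    · exact (hA _ _ ((hB n f hf).2 hj)).1 (by omega)
  · intro h
    have := (hA _ _ ((hB n f hf).2 (by omega))).2 (by omega)
    rwa [Nat.sub_sub, add_comm j i] at this

theorem smul_mem_lowering (c : K) (j : ℕ) (A : Module.End K (Fock K)) (hA : A ∈ lowering K j) :
    c • A ∈ lowering K j := by
  intro n f hf
  refine ⟨fun h => ?_, fun h => Submodule.smul_mem _ _ ((hA n f hf).2 h)⟩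
  rw [LinearMap.smul_apply, (hA n f hf).1 h, smul_zero]

theorem pderiv_mem_lowering (i : ℕ+) :
    ((pderiv i).toLinearMap : Module.End K (Fock K)) ∈ lowering K i := by
  intro n f hf
  constructor
  · intro h
    -- A monomial of weight less than `i` does not involve `p_i`.
    refine pderiv_eq_zero_of_notMem_vars fun hi => ?_
    obtain ⟨a, ha, hia⟩ := (mem_vars_iff_mem_support i).mp hi
    have hw : Finsupp.weight deg a = n := hf (mem_support_iff.mp ha)
    have h2 := Finsupp.le_weight_of_ne_zero' deg (Finsupp.mem_support_iff.mp hia)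
    rw [hw] at h2
    exact absurd h (not_lt.mpr h2)
  · intro h
    exact IsWeightedHomogeneous.pderiv (n := n) hf (by simp only [deg]; omega)

theorem coeff_annihilation_mem_lowering (b : ℕ → K) (j : ℕ) :
    PowerSeries.coeff j (annihilation b) ∈ lowering K j := by
  refine coeff_fexp_mem (lowering K) (fun n f hf => ⟨fun h => absurd h (Nat.not_lt_zero _),
    fun _ => hf⟩) mul_mem_lowering (fun m => smul_mem_lowering _) (fun d => ?_) j
  rw [PowerSeries.coeff_mk]
  split_ifs with h
  · exact zero_mem _
  · have := pderiv_mem_lowering (K := K) d.toPNat'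
    rw [Nat.toPNat'_coe, if_pos (Nat.pos_of_ne_zero h)] at this
    exact smul_mem_lowering _ _ _ this

theorem coeff_creation_mem (a : ℕ → K) (j : ℕ) :
    PowerSeries.coeff j (creation a) ∈ FockDeg K j := by
  refine coeff_fexp_mem (fun j => (FockDeg K j).toAddSubmonoid) (isWeightedHomogeneous_one K deg)
    (fun i j x y hx hy => IsWeightedHomogeneous.mul hx hy)
    (fun m i x hx => Submodule.smul_mem _ _ hx) (fun d => ?_) j
  rw [PowerSeries.coeff_mk]
  split_ifs with h
  · exact zero_mem _
  · refine Submodule.smul_mem _ _ ?_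
    have := isWeightedHomogeneous_X K deg d.toPNat'
    rwa [deg, Nat.toPNat'_coe, if_pos (Nat.pos_of_ne_zero h)] at this

theorem vertexMode_apply (a b : ℕ → K) (d n : ℕ) {f : Fock K} (hf : f ∈ FockDeg K n) :
    vertexMode a b d f = ∑ j ∈ Finset.range (n + 1), if d ≤ j then
      PowerSeries.coeff (j - d) (creation a) * PowerSeries.coeff j (annihilation b) f else 0 := by
  rw [vertexMode, ofGraded_apply _ hf, LinearMap.sum_apply]
  refine Finset.sum_congr rfl fun j _ => ?_
  by_cases h : d ≤ j
  · rw [if_pos (by exact_mod_cast h), if_pos h, Module.End.mul_apply, LinearMap.mulLeft_apply,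
      ← Nat.cast_sub h, Int.toNat_natCast]
  · rw [if_neg (by exact_mod_cast h), if_neg h, LinearMap.zero_apply]

theorem vertexMode_mem_lowering (a b : ℕ → K) (d : ℕ) : vertexMode a b d ∈ lowering K d := by
  intro n f hf
  rw [vertexMode_apply a b d n hf]
  constructor
  · intro h
    refine Finset.sum_eq_zero fun j hj => if_neg ?_
    have := Finset.mem_range.mp hj
    omega
  · intro h
    refine Submodule.sum_mem _ fun j hj => ?_
    have hj' := Finset.mem_range.mp hj
    split_ifs with hd
    · have := IsWeightedHomogeneous.mul (coeff_creation_mem a (j - d))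
        ((coeff_annihilation_mem_lowering b j n f hf).2 (by omega))
      rwa [show j - d + (n - j) = n - d by omega] at this
    · exact zero_mem _

/-- Multiplying a current by a creation current `exp(∑ c_n p_n z^n)` on the left. -/
theorem sum_creation_mul_vertexMode [CharZero K] (c a b : ℕ → K) (d n N : ℕ) (hN : n ≤ N + d)
    {f : Fock K} (hf : f ∈ FockDeg K n) :
    ∑ m ∈ Finset.range (N + 1),
        PowerSeries.coeff m (creation c) * vertexMode a b ((d + m : ℕ) : ℤ) f =
      vertexMode (fun n => c n + a n) b d f := by
  rw [vertexMode_apply _ b d n hf, creation_add]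
  simp_rw [vertexMode_apply a b _ n hf, Finset.mul_sum]
  rw [Finset.sum_comm]
  refine Finset.sum_congr rfl fun j hj => ?_
  have hj' := Finset.mem_range.mp hj
  split_ifs with h
  · rw [PowerSeries.coeff_mul, Finset.sum_mul, Finset.Nat.sum_antidiagonal_eq_sum_range_succ
      (fun x y => PowerSeries.coeff x (creation c) * PowerSeries.coeff y (creation a) *
        PowerSeries.coeff j (annihilation b) f)]
    symm
    refine Finset.sum_subset_zero_on_sdiff (Finset.range_subset_range.mpr (by omega))
      (fun m hm => ?_) fun m hm => ?_
    · simp only [Finset.mem_sdiff, Finset.mem_range] at hm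
      rw [if_neg (by omega), mul_zero]
    · have := Finset.mem_range.mp hm
      rw [if_pos (by omega), mul_assoc, Nat.sub_sub]
  · refine Finset.sum_eq_zero fun m _ => ?_
    rw [if_neg (by omega), mul_zero]

end VertexOperators

/-! ### The deformed Virasoro current and the currents `η(z)` and `D(z)` -/

section Dressing

variable {K : Type*} [Field K]

theorem vertexMode_congr {a a' : ℕ → K} (h : ∀ n, 0 < n → a n = a' n) (b : ℕ → K) (d : ℤ) :
    vertexMode a b d = vertexMode a' b d := by
  rw [vertexMode, vertexMode, creation_congr h]

theorem vertexMode_scaled (a b : ℕ → K) {s : K} (hs : s ≠ 0) (d n : ℕ) {f : Fock K}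
    (hf : f ∈ FockDeg K n) :
    vertexMode (fun n => a n * (s⁻¹) ^ n) (fun n => b n * s ^ n) d f =
      s ^ d • vertexMode a b d f := by
  rw [vertexMode_apply _ _ d n hf, vertexMode_apply _ _ d n hf, Finset.smul_sum]
  refine Finset.sum_congr rfl fun j _ => ?_
  split_ifs with h
  · rw [coeff_creation_scaled, coeff_annihilation_scaled, LinearMap.smul_apply,
      smul_mul_smul_comm]
    congr 1
    obtain ⟨e, rfl⟩ := Nat.exists_eq_add_of_le h
    rw [Nat.add_sub_cancel_left, pow_add, inv_pow]
    field_simp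
  · rw [smul_zero]

/-- Without a creation part, a mode of a current is a mode of its annihilation part. -/
theorem vertexMode_zero (b : ℕ → K) (d n : ℕ) {f : Fock K} (hf : f ∈ FockDeg K n) :
    vertexMode (fun _ => 0) b d f = PowerSeries.coeff d (annihilation b) f := by
  rw [vertexMode_apply _ _ d n hf, creation_zero]
  rcases lt_or_ge n d with h | h
  · rw [(coeff_annihilation_mem_lowering b d n f hf).1 h]
    refine Finset.sum_eq_zero fun j hj => if_neg ?_
    have := Finset.mem_range.mp hj
    omega
  · rw [Finset.sum_eq_single d]
    · simp
    · intro j _ hjd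
      split_ifs with hd
      · rw [PowerSeries.coeff_one, if_neg (by omega), zero_mul]
      · rfl
    · intro hd
      exact absurd (Finset.mem_range.mpr (by omega)) hd

/-- The coefficients of the logarithm of the creation current
`exp(∑_{n>0} (1-t^{-n})/(1+(q/t)^n) p_n/n s^n z^n)`. Multiplication by this current removes the
creation part of the second summand of `T(z)` and turns the one of the first summand into the
creation part of `η(z/s)`. -/
def dressing (q t s : K) (n : ℕ) : K := (1 - (t ^ n)⁻¹) / (1 + (q / t) ^ n) / n * s ^ n

/-- The identity of currents
`exp(∑_{n>0} (1-t^{-n})/(1+(q/t)^n) p_n/n s^n z^n) T(z) = k η(z/s) + k⁻¹ D(sz)`, in modes. -/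
theorem sum_dressing_mul_Tmode [CharZero K] {q t s : K} (k : K) (hs0 : s ≠ 0)
    (hs : s ^ 2 = q / t) (hqt : ∀ n, 0 < n → 1 + (q / t) ^ n ≠ 0) (d n N : ℕ) (hN : n ≤ N + d)
    {f : Fock K} (hf : f ∈ FockDeg K n) :
    ∑ m ∈ Finset.range (N + 1),
        PowerSeries.coeff m (creation (dressing q t s)) * Tmode q t s k ((d + m : ℕ) : ℤ) f =
      (k * s ^ d) • eta q t d f + (k⁻¹ * (s⁻¹) ^ d) • Dop q d f := by
  simp only [Tmode, LinearMap.add_apply, LinearMap.smul_apply, mul_add, mul_smul_comm]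
  rw [Finset.sum_add_distrib, ← Finset.smul_sum, ← Finset.smul_sum,
    sum_creation_mul_vertexMode _ _ _ d n N hN hf, sum_creation_mul_vertexMode _ _ _ d n N hN hf]
  have h1 : ∀ n, 0 < n → dressing q t s n +
      (1 - (t ^ n)⁻¹) / (1 + (q / t) ^ n) / n * (s ^ n)⁻¹ =
        (1 - (t ^ n)⁻¹) / n * (s⁻¹) ^ n := by
    intro n hn
    have h := hqt n hn
    have hn0 : (n : K) ≠ 0 := Nat.cast_ne_zero.mpr hn.ne'
    have hsn : s ^ n ≠ 0 := pow_ne_zero n hs0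
    rw [dressing, inv_pow]
    rw [← hs, ← pow_mul, mul_comm 2 n, pow_mul] at h ⊢
    generalize (1 - (t ^ n)⁻¹) = x
    field_simp
    ring
  have h2 : ∀ n, 0 < n → dressing q t s n +
      -((1 - (t ^ n)⁻¹) / (1 + (q / t) ^ n) / n * s ^ n) = 0 := by
    intro n _
    rw [dressing, add_neg_cancel]
  rw [vertexMode_congr h1, vertexMode_congr h2, vertexMode_zero _ d n hf]
  have h3 : (fun n => -((1 - q ^ n) * s ^ n)) = fun n => (-(1 - q ^ n)) * s ^ n := by
    funext n; ring
  have h4 : (fun n => (1 - q ^ n) * (s ^ n)⁻¹) = fun n => (1 - q ^ n) * (s⁻¹) ^ n := by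
    funext n; rw [inv_pow]
  rw [h3, h4, vertexMode_scaled _ _ hs0 d n hf, coeff_annihilation_scaled, LinearMap.smul_apply,
    smul_smul, smul_smul]
  rfl

/-- A triangular system of equations with ones on the diagonal, whose right-hand side is supported
at index `1`. -/
theorem forall_eq_ite_iff_forall_sum_eq_ite {R : Type*} [Ring R] {ψ : ℕ → R} (h0 : ψ 0 = 1)
    (n : ℕ) (x : ℕ → R) (z : R) :
    (∀ d, 1 ≤ d → d ≤ n → x d = if d = 1 then z else 0) ↔
      ∀ d, 1 ≤ d → d ≤ n →
        ∑ m ∈ Finset.range (n - d + 1), ψ m * x (d + m) = if d = 1 then z else 0 := by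
  have step : ∀ d, 1 ≤ d → d ≤ n →
      (∀ e, d < e → e ≤ n → x e = if e = 1 then z else 0) →
      ∑ m ∈ Finset.range (n - d + 1), ψ m * x (d + m) = x d := by
    intro d hd hdn h
    rw [Finset.sum_range_succ', Finset.sum_eq_zero, zero_add, h0, one_mul, add_zero]
    intro m hm
    have := Finset.mem_range.mp hm
    rw [h _ (by omega) (by omega), if_neg (by omega), mul_zero]
  constructor
  · intro h d hd hdn
    rw [step d hd hdn fun e he hen => h e (by omega) hen, h d hd hdn]
  · intro h
    -- Descending induction on the index.
    have main : ∀ r d, n - d = r → 1 ≤ d → d ≤ n → x d = if d = 1 then z else 0 := by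
      intro r
      induction r using Nat.strong_induction_on with
      | _ r ih =>
        intro d hr hd hdn
        rw [← h d hd hdn, step d hd hdn fun e he hen => ih (n - e) (by omega) e rfl (by omega) hen]
    exact fun d => main _ d rfl

theorem Tmode_mem_lowering (q t s k : K) (d : ℕ) : Tmode q t s k d ∈ lowering K d :=
  add_mem (smul_mem_lowering _ _ _ (vertexMode_mem_lowering _ _ d))
    (smul_mem_lowering _ _ _ (vertexMode_mem_lowering _ _ d))

theorem coe_lower_of_mem_lowering {A : Module.End K (Fock K)} {d : ℕ} (hA : A ∈ lowering K d)
    (w : FockHat K) (m : ℕ) : (lower A d w m : Fock K) = A (w (m + d)) := by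
  have := (hA _ _ (w (m + d)).2).2 (by omega)
  rw [Nat.add_sub_cancel] at this
  exact weightedHomogeneousComponent_eq_self this

theorem isWhittaker_iff_forall_Tmode (q t s k L : K) (w : FockHat K) :
    IsWhittaker q t s k L w ↔ ∀ n d : ℕ, 1 ≤ d → d ≤ n →
      Tmode q t s k d (w n) = if d = 1 then L • (w (n - 1) : Fock K) else 0 := by
  constructor
  · rintro ⟨h1, h2⟩ n d hd hdn
    obtain ⟨m, rfl⟩ := Nat.exists_eq_add_of_le' hdn
    rw [← coe_lower_of_mem_lowering (Tmode_mem_lowering q t s k d)]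
    split_ifs with hd1
    · subst hd1
      exact congrArg Subtype.val (congrFun h1 m)
    · rw [h2 d (by omega)]
      rfl
  · intro h
    refine ⟨?_, fun d hd => ?_⟩
    · funext m
      refine Subtype.ext ?_
      have h1 := h (m + 1) 1 le_rfl (by omega)
      rw [if_pos rfl] at h1
      have h2 := coe_lower_of_mem_lowering (Tmode_mem_lowering q t s k 1) w m
      rw [h1] at h2
      exact h2
    · funext m
      refine Subtype.ext ?_
      rw [coe_lower_of_mem_lowering (Tmode_mem_lowering q t s k d),
        h (m + d) d (by omega) (by omega), if_neg (by omega)]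
      rfl

/-- The Whittaker condition in terms of `η_d` and `D_d`: the dressing current is invertible, and
multiplication by it does not affect the right-hand sides, since `T_d w` is required to vanish
for `d ≥ 2`. -/
theorem isWhittaker_iff_forall_eta_Dop [CharZero K] {q t s : K} (k L : K) (hs0 : s ≠ 0)
    (hs : s ^ 2 = q / t) (hqt : ∀ n, 0 < n → 1 + (q / t) ^ n ≠ 0) (w : FockHat K) :
    IsWhittaker q t s k L w ↔ ∀ n d : ℕ, 1 ≤ d → d ≤ n →
      (k * s ^ d) • eta q t d (w n : Fock K) + (k⁻¹ * (s⁻¹) ^ d) • Dop q d (w n : Fock K) =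
        if d = 1 then L • (w (n - 1) : Fock K) else 0 := by
  rw [isWhittaker_iff_forall_Tmode]
  refine forall_congr' fun n => ?_
  rw [forall_eq_ite_iff_forall_sum_eq_ite 
    (ψ := fun m => PowerSeries.coeff m (creation (dressing q t s)))
    (coeff_zero_creation (dressing q t s)) n
    (fun d => Tmode q t s k d (w n)) (L • (w (n - 1) : Fock K))]
  refine forall_congr' fun d => forall_congr' fun _ => forall_congr' fun hdn => ?_
  rw [sum_dressing_mul_Tmode k hs0 hs hqt d n (n - d) (by omega) (w n).2]

theorem eta_mem_lowering (q t : K) (d : ℕ) : eta q t d ∈ lowering K d :=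
  vertexMode_mem_lowering _ _ d

theorem Dop_mem_lowering (q : K) (d : ℕ) : Dop q d ∈ lowering K d :=
  coeff_annihilation_mem_lowering _ d

/-- The Whittaker condition on `v_G`, after removing the normalization of its components. -/
theorem isWhittaker_vG_iff [CharZero K] {q t s k L : K} (hs0 : s ≠ 0) (hk : k ≠ 0) (hL : L ≠ 0)
    (hs : s ^ 2 = q / t) (hqt : ∀ n, 0 < n → 1 + (q / t) ^ n ≠ 0) :
    IsWhittaker q t s k L (vG q t s k L) ↔ ∀ n d : ℕ, 1 ≤ d →
      (k ^ 2 * q / t * (q / t) ^ (d - 1)) • eta q t d (vAt q t (k ^ 2 * q / t) n)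
          + Dop q d (vAt q t (k ^ 2 * q / t) n) =
        if d = 1 ∧ 1 ≤ n then vAt q t (k ^ 2 * q / t) (n - 1) else 0 := by
  rw [isWhittaker_iff_forall_eta_Dop k L hs0 hs hqt]
  refine forall_congr' fun n => forall_congr' fun d => forall_congr' fun hd => ?_
  have hv := vAt_homogeneous q t (k ^ 2 * q / t) n
  rcases lt_or_ge n d with hnd | hnd
  · refine iff_of_true (fun h => absurd h (by omega)) ?_
    rw [(eta_mem_lowering q t d n _ hv).1 hnd, (Dop_mem_lowering q d n _ hv).1 hnd,
      if_neg (by omega), smul_zero, add_zero]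
  · have hc : L ^ n * (s * k) ^ n * (k⁻¹ * (s⁻¹) ^ d) ≠ 0 := by positivity
    refine Iff.trans ?_ (smul_right_injective (Fock K) hc).eq_iff
    rw [imp_iff_right hnd, iff_iff_eq]
    congr 1
    · simp only [vG, map_smul, smul_add, smul_smul]
      congr 2
      · obtain ⟨e, rfl⟩ := Nat.exists_eq_add_of_le hd
        have : k ^ 2 * q / t = k ^ 2 * s ^ 2 := by rw [hs, mul_div_assoc]
        rw [this, ← hs, Nat.add_sub_cancel_left, inv_pow]
        field_simp
        ring
      · rw [← mul_comm]
    · by_cases h1 : d = 1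
      · subst h1
        rw [if_pos rfl, if_pos ⟨rfl, hnd⟩]
        obtain ⟨e, rfl⟩ := Nat.exists_eq_add_of_le' hnd
        simp only [vG, smul_smul, Nat.add_sub_cancel]
        congr 1
        field_simp
        ring
      · rw [if_neg h1, if_neg (fun h => h1 h.1), smul_zero]

end Dressing

/-! ### Fields of definition -/

section Rationality

variable {K : Type*} [Field K]

/-- The polynomials all of whose coefficients lie in the subfield `F`. -/
def ratPoly (F : Subfield K) (σ : Type*) : Subring (MvPolynomial σ K) :=
  (MvPolynomial.map F.subtype).range

theorem mem_ratPoly {F : Subfield K} {σ : Type*} {f : MvPolynomial σ K} :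
    f ∈ ratPoly F σ ↔ ∀ a, coeff a f ∈ F := by
  constructor
  · rintro ⟨g, rfl⟩ a
    rw [coeff_map]
    exact (coeff a g).2
  · intro h
    rw [f.as_sum]
    refine sum_mem fun a _ => ⟨monomial a ⟨_, h a⟩, ?_⟩
    rw [map_monomial]
    rfl

theorem X_mem_ratPoly (F : Subfield K) {σ : Type*} (i : σ) : X i ∈ ratPoly F σ :=
  ⟨X i, map_X _ _⟩

theorem smul_mem_ratPoly {F : Subfield K} {σ : Type*} {c : K} (hc : c ∈ F)
    {f : MvPolynomial σ K} (hf : f ∈ ratPoly F σ) : c • f ∈ ratPoly F σ := by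
  rw [mem_ratPoly] at hf ⊢
  intro a
  rw [coeff_smul]
  exact mul_mem hc (hf a)

/-- The operators on `Λ_K` that are defined over the subfield `F`. -/
def ratEnd (F : Subfield K) : AddSubmonoid (Module.End K (Fock K)) where
  carrier := {A | ∀ f ∈ ratPoly F ℕ+, A f ∈ ratPoly F ℕ+}
  zero_mem' := fun _ _ => zero_mem _
  add_mem' := fun hA hB f hf => add_mem (hA f hf) (hB f hf)

theorem smul_mem_ratEnd {F : Subfield K} {c : K} (hc : c ∈ F) {A : Module.End K (Fock K)}
    (hA : A ∈ ratEnd F) : c • A ∈ ratEnd F :=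
  fun f hf => smul_mem_ratPoly hc (hA f hf)

theorem inv_factorial_mem (F : Subfield K) (m : ℕ) : ((m.factorial : K)⁻¹) ∈ F :=
  inv_mem (natCast_mem F _)

theorem coeff_creation_mem_ratPoly {F : Subfield K} {c : ℕ → K} (hc : ∀ n, c n ∈ F) (d : ℕ) :
    PowerSeries.coeff d (creation c) ∈ ratPoly F ℕ+ := by
  refine coeff_fexp_mem (fun _ => (ratPoly F ℕ+).toAddSubgroup.toAddSubmonoid)
    (one_mem (ratPoly F ℕ+)) (fun _ _ x y hx hy => (ratPoly F ℕ+).mul_mem hx hy)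
    (fun m _ x hx => smul_mem_ratPoly (inv_factorial_mem F m) hx) (fun n => ?_) d
  rw [PowerSeries.coeff_mk]
  split_ifs
  · exact zero_mem _
  · exact smul_mem_ratPoly (hc n) (X_mem_ratPoly F _)

theorem coeff_annihilation_mem_ratEnd {F : Subfield K} {c : ℕ → K} (hc : ∀ n, c n ∈ F) (d : ℕ) :
    PowerSeries.coeff d (annihilation c) ∈ ratEnd F := by
  refine coeff_fexp_mem (fun _ => ratEnd F) (fun f hf => hf)
    (fun _ _ x y hx hy f hf => hx _ (hy f hf))
    (fun m _ x hx => smul_mem_ratEnd (inv_factorial_mem F m) hx) (fun n => ?_) d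
  rw [PowerSeries.coeff_mk]
  split_ifs
  · exact zero_mem _
  · refine smul_mem_ratEnd (hc n) ?_
    rintro _ ⟨g, rfl⟩
    exact ⟨pderiv n.toPNat' g, (pderiv_map (i := n.toPNat')).symm⟩

theorem vertexMode_mem_ratEnd {F : Subfield K} {a b : ℕ → K} (ha : ∀ n, a n ∈ F)
    (hb : ∀ n, b n ∈ F) (d : ℕ) : vertexMode a b d ∈ ratEnd F := by
  intro f hf
  rw [f.as_sum, map_sum]
  refine sum_mem fun e _ => ?_
  have hm : (monomial e (coeff e f) : Fock K) ∈ ratPoly F ℕ+ := by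
    rw [mem_ratPoly]
    intro e'
    rw [coeff_monomial]
    split_ifs
    · exact mem_ratPoly.mp hf e
    · exact zero_mem F
  rw [vertexMode_apply a b d _ (isWeightedHomogeneous_monomial deg e _ rfl)]
  refine sum_mem fun j _ => ?_
  split_ifs
  · exact mul_mem (coeff_creation_mem_ratPoly ha _) (coeff_annihilation_mem_ratEnd hb j _ hm)
  · exact zero_mem _

variable {F : Subfield K} {q t : K}

theorem eta_mem_ratEnd (hq : q ∈ F) (ht : t ∈ F) (d : ℕ) : eta q t d ∈ ratEnd F :=
  vertexMode_mem_ratEnd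
    (fun n => div_mem (sub_mem (one_mem F) (inv_mem (pow_mem ht n))) (natCast_mem F n))
    (fun n => neg_mem (sub_mem (one_mem F) (pow_mem hq n))) d

theorem Dop_mem_ratEnd (hq : q ∈ F) (d : ℕ) : Dop q d ∈ ratEnd F :=
  coeff_annihilation_mem_ratEnd (fun n => sub_mem (one_mem F) (pow_mem hq n)) d

theorem pPart_mem_ratPoly (F : Subfield K) {n : ℕ} (lam : n.Partition) :
    pPart K lam ∈ ratPoly F ℕ+ := by
  refine multiset_prod_mem _ fun x hx => ?_
  obtain ⟨i, _, rfl⟩ := Multiset.mem_map.mp hx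
  exact X_mem_ratPoly F _

theorem transition_mem (F : Subfield K) {n : ℕ} (mu lam : n.Partition) :
    transition K n mu lam ∈ F := by
  refine mem_ratPoly.mp (multiset_prod_mem _ fun x hx => ?_) _
  obtain ⟨i, _, rfl⟩ := Multiset.mem_map.mp hx
  exact sum_mem fun j _ => pow_mem (X_mem_ratPoly F j) i

theorem matrix_inv_mem {ι : Type*} [Fintype ι] [DecidableEq ι] {A : Matrix ι ι K}
    (hA : ∀ i j, A i j ∈ F) (i j : ι) : A⁻¹ i j ∈ F := by
  let B : Matrix ι ι F := fun i j => ⟨A i j, hA i j⟩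
  have hAB : A = F.subtype.mapMatrix B := rfl
  rw [Matrix.inv_def, Ring.inverse_eq_inv', hAB, ← RingHom.map_det, ← RingHom.map_adjugate]
  exact mul_mem (inv_mem (B.det).2) (B.adjugate i j).2

theorem mPart_mem_ratPoly (F : Subfield K) {n : ℕ} (lam : n.Partition) :
    (mPart lam : Fock K) ∈ ratPoly F ℕ+ :=
  sum_mem fun mu _ => smul_mem_ratPoly (matrix_inv_mem (transition_mem F) _ _)
    (pPart_mem_ratPoly F mu)

theorem ip_mem (hq : q ∈ F) (ht : t ∈ F) {f g : Fock K} (hf : f ∈ ratPoly F ℕ+)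
    (hg : g ∈ ratPoly F ℕ+) : ip q t f g ∈ F := by
  refine sum_mem fun a _ => mul_mem (mul_mem (mem_ratPoly.mp hf a) (mem_ratPoly.mp hg a)) ?_
  exact prod_mem fun i _ => mul_mem
    (mul_mem (pow_mem (natCast_mem F _) _) (natCast_mem F _))
    (pow_mem (div_mem (sub_mem (one_mem F) (pow_mem hq _)) (sub_mem (one_mem F) (pow_mem ht _))) _)

theorem macP_mem_ratPoly (hq : q ∈ F) (ht : t ∈ F) {n : ℕ} (lam : n.Partition) :
    macP q t lam ∈ ratPoly F ℕ+ := by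
  induction h : (below lam).card using Nat.strong_induction_on generalizing lam with
  | _ N ih =>
    rw [macP]
    refine sub_mem (mPart_mem_ratPoly F lam) (sum_mem fun mu _ => ?_)
    have := ih _ (h ▸ below_card_lt mu.2) mu.1 rfl
    exact smul_mem_ratPoly (div_mem (ip_mem hq ht (mPart_mem_ratPoly F lam) this)
      (ip_mem hq ht this this)) this

theorem macJ_mem_ratPoly (hq : q ∈ F) (ht : t ∈ F) {n : ℕ} (lam : n.Partition) :
    macJ q t lam ∈ ratPoly F ℕ+ :=
  smul_mem_ratPoly (prod_mem fun _ _ => sub_mem (one_mem F)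
    (mul_mem (pow_mem hq _) (pow_mem ht _))) (macP_mem_ratPoly hq ht lam)

theorem vCoeff_mem (hq : q ∈ F) (ht : t ∈ F) {n : ℕ} (lam : n.Partition) : vCoeff q t lam ∈ F :=
  div_mem (pow_mem hq _) (ip_mem hq ht (macJ_mem_ratPoly hq ht lam) (macJ_mem_ratPoly hq ht lam))

theorem letter_mem (hq : q ∈ F) (ht : t ∈ F) (b : ℕ × ℕ) : letter q t b ∈ F :=
  mul_mem (pow_mem hq _) (inv_mem (pow_mem ht _))

end Rationality

/-! ### The Macdonald inner product is anisotropic over `ℚ(q,t)` -/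

section Anisotropy

variable {K : Type*} [Field K]

/-- The subfield `ℚ(q,t)` of `K`. -/
def ratField [Algebra ℚ K] (q t : K) : Subfield K :=
  (IntermediateField.adjoin ℚ (Set.range ![q, t])).toSubfield

theorem left_mem_ratField [Algebra ℚ K] (q t : K) : q ∈ ratField q t :=
  IntermediateField.subset_adjoin ℚ _ ⟨0, rfl⟩

theorem right_mem_ratField [Algebra ℚ K] (q t : K) : t ∈ ratField q t :=
  IntermediateField.subset_adjoin ℚ _ ⟨1, rfl⟩

theorem exists_eq_div_of_mem_ratField [Algebra ℚ K] {q t x : K}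
    (hx : x ∈ ratField q t) :
    ∃ r s : MvPolynomial (Fin 2) ℚ, s ≠ 0 ∧ x = aeval ![q, t] r / aeval ![q, t] s := by
  obtain ⟨r, s, h⟩ := (IntermediateField.mem_adjoin_range_iff ℚ _ x).mp hx
  by_cases hs : s = 0
  · exact ⟨0, 1, one_ne_zero, by rw [h, hs]; simp⟩
  · exact ⟨r, s, hs, h⟩

/-- A sum of fractions in `q` and `t` does not vanish if, at some rational point, the denominators
are positive, the numerators are nonnegative, and one of the numerators is positive. -/
theorem sum_div_ne_zero_of_eval [Algebra ℚ K] {q t : K} (hind : AlgebraicIndependent ℚ ![q, t])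
    {ι : Type*} [DecidableEq ι] (S : Finset ι) (N M : ι → MvPolynomial (Fin 2) ℚ)
    (p : Fin 2 → ℚ) (hM : ∀ a ∈ S, 0 < eval p (M a)) (hN : ∀ a ∈ S, 0 ≤ eval p (N a)) {a₀ : ι}
    (ha₀ : a₀ ∈ S) (hpos : 0 < eval p (N a₀)) :
    ∑ a ∈ S, aeval ![q, t] (N a) / aeval ![q, t] (M a) ≠ 0 := by
  have hinj : Function.Injective (aeval ![q, t] : MvPolynomial (Fin 2) ℚ →ₐ[ℚ] K) := hind
  have hM0 : ∀ a ∈ S, aeval ![q, t] (M a) ≠ 0 := by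
    intro a ha h
    have h0 : M a = 0 := hinj (by rw [h, map_zero])
    have := hM a ha
    rw [h0, map_zero] at this
    exact lt_irrefl _ this
  have hsum : ∑ a ∈ S, aeval ![q, t] (N a) / aeval ![q, t] (M a) =
      aeval ![q, t] (∑ a ∈ S, N a * ∏ b ∈ S.erase a, M b) /
        ∏ b ∈ S, aeval ![q, t] (M b) := by
    rw [map_sum, Finset.sum_div]
    refine Finset.sum_congr rfl fun a ha => ?_
    rw [map_mul, map_prod, ← Finset.mul_prod_erase S _ ha, mul_comm (aeval ![q, t] (M a)),
      ← mul_div_mul_right _ _ (Finset.prod_ne_zero_iff.mpr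
        fun b hb => hM0 b (Finset.mem_of_mem_erase hb)), mul_comm (aeval ![q, t] (M a))]
  rw [hsum]
  refine div_ne_zero (fun h => ?_) (Finset.prod_ne_zero_iff.mpr hM0)
  have h0 : ∑ a ∈ S, N a * ∏ b ∈ S.erase a, M b = 0 := hinj (by rw [h, map_zero])
  have h1 := congrArg (eval p) h0
  rw [map_sum, map_zero] at h1
  have hprod : ∀ a, 0 < eval p (∏ b ∈ S.erase a, M b) := by
    intro a
    rw [map_prod]
    exact Finset.prod_pos fun b hb => hM b (Finset.mem_of_mem_erase hb)
  have h2 : 0 < ∑ a ∈ S, eval p (N a * ∏ b ∈ S.erase a, M b) := by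
    refine Finset.sum_pos' (fun a ha => ?_) ⟨a₀, ha₀, ?_⟩
    · rw [map_mul]
      exact mul_nonneg (hN a ha) (hprod a).le
    · rw [map_mul]
      exact mul_pos hpos (hprod a₀)
  exact h2.ne' h1

/-- A nonzero polynomial over `ℚ` does not vanish identically on the open unit square. -/
theorem exists_eval_ne_zero_of_ne_zero {σ : Type*} {P : MvPolynomial σ ℚ} (hP : P ≠ 0) :
    ∃ p : σ → ℚ, (∀ i, 0 < p i ∧ p i < 1) ∧ eval p P ≠ 0 := by
  by_contra! h
  refine hP (funext_set (fun _ => Set.Ioo 0 1) (fun _ => Set.Ioo_infinite one_pos) fun p hp => ?_)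
  rw [map_zero]
  exact h p fun i => hp i (Set.mem_univ i)

/-- The squared norm of the power sum product `∏ p_i^{a_i}`. -/
def pNorm (q t : K) (a : ℕ+ →₀ ℕ) : K :=
  a.prod fun i m => ((i : ℕ) : K) ^ m * (m.factorial : K) *
    ((1 - q ^ (i : ℕ)) / (1 - t ^ (i : ℕ))) ^ m

/-- The squared norms of the power sum products are positive for `0 < q < 1` and `0 < t < 1`. -/
theorem exists_pNorm_eq_div [Algebra ℚ K] (q t : K) (a : ℕ+ →₀ ℕ) :
    ∃ m n : MvPolynomial (Fin 2) ℚ, pNorm q t a = aeval ![q, t] m / aeval ![q, t] n ∧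
      ∀ p : Fin 2 → ℚ, (∀ i, 0 < p i ∧ p i < 1) → 0 < eval p m ∧ 0 < eval p n := by
  refine ⟨a.prod fun i m => (((i : ℕ) : MvPolynomial (Fin 2) ℚ) ^ m *
    (m.factorial : MvPolynomial (Fin 2) ℚ)) *
    (1 - X 0 ^ (i : ℕ)) ^ m, a.prod fun i m => (1 - X 1 ^ (i : ℕ)) ^ m, ?_, fun p hp => ?_⟩
  · simp only [pNorm, Finsupp.prod, map_prod, ← Finset.prod_div_distrib, map_mul, map_pow, map_sub,
      map_one, map_natCast, aeval_X, div_pow]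
    refine Finset.prod_congr rfl fun i _ => ?_
    rw [mul_div_assoc]
    rfl
  · have h1 : ∀ (i : Fin 2) (j : ℕ+), 0 < 1 - p i ^ (j : ℕ) := fun i j =>
      sub_pos.mpr (pow_lt_one₀ (hp i).1.le (hp i).2 j.ne_zero)
    simp only [Finsupp.prod, map_prod, map_mul, map_pow, map_sub, map_one, map_natCast, eval_X]
    refine ⟨Finset.prod_pos fun i _ => ?_, Finset.prod_pos fun i _ => pow_pos (h1 1 i) _⟩
    have hi : (0 : ℚ) < ((i : ℕ) : ℚ) := Nat.cast_pos.mpr i.pos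
    have hf : (0 : ℚ) < ((a i).factorial : ℚ) := Nat.cast_pos.mpr (Nat.factorial_pos _)
    exact mul_pos (mul_pos (pow_pos hi _) hf) (pow_pos (h1 0 i) _)

/-- A nonzero symmetric function defined over `ℚ(q,t)` is not isotropic: at a generic rational
point of the unit square its squared norm is a sum of squares with positive coefficients. -/
theorem ip_self_ne_zero [Algebra ℚ K] {q t : K} (hind : AlgebraicIndependent ℚ ![q, t])
    {f : Fock K} (hf : f ∈ ratPoly (ratField q t) ℕ+) (hf0 : f ≠ 0) : ip q t f f ≠ 0 := by
  classical
  have hinj : Function.Injective (aeval ![q, t] : MvPolynomial (Fin 2) ℚ →ₐ[ℚ] K) := hind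
  choose r s hs hrs using fun a => exists_eq_div_of_mem_ratField (mem_ratPoly.mp hf a)
  choose m n hmn hpos using fun a => exists_pNorm_eq_div q t a
  obtain ⟨a₀, ha₀⟩ := support_nonempty.mpr hf0
  have hr0 : r a₀ ≠ 0 := by
    intro h
    have := hrs a₀
    rw [h, map_zero, zero_div] at this
    exact mem_support_iff.mp ha₀ this
  obtain ⟨p, hp, hpne⟩ := exists_eval_ne_zero_of_ne_zero
    (mul_ne_zero hr0 (Finset.prod_ne_zero_iff.mpr fun a (_ : a ∈ f.support) => hs a))
  rw [map_mul, map_prod] at hpne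
  have hsp := Finset.prod_ne_zero_iff.mp (right_ne_zero_of_mul hpne)
  have key := sum_div_ne_zero_of_eval hind f.support (fun a => r a ^ 2 * m a)
    (fun a => s a ^ 2 * n a) p
    (fun a ha => by
      rw [map_mul, map_pow]
      exact mul_pos (sq_pos_of_ne_zero (hsp a ha)) (hpos a p hp).2)
    (fun a _ => by
      rw [map_mul, map_pow]
      exact mul_nonneg (sq_nonneg _) (hpos a p hp).1.le) ha₀
    (by
      rw [map_mul, map_pow]
      exact mul_pos (sq_pos_of_ne_zero (left_ne_zero_of_mul hpne)) (hpos a₀ p hp).1)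
  refine ne_of_eq_of_ne (Finset.sum_congr rfl fun a _ => ?_) key
  have hnorm := hmn a
  rw [pNorm] at hnorm
  rw [hnorm, hrs a]
  simp only [map_mul, map_pow]
  rw [div_mul_div_comm, div_mul_div_comm, sq, sq]

end Anisotropy

/-! ### Orthogonality of the Macdonald symmetric functions -/

section Orthogonality

variable {K : Type*} [Field K]

/-- The Macdonald inner product with a fixed second argument, as a linear form. -/
def ipForm (q t : K) (g : Fock K) : Fock K →ₗ[K] K :=
  (basisMonomials ℕ+ K).constr K fun a => coeff a g * pNorm q t a

theorem ipForm_apply (q t : K) (f g : Fock K) : ipForm q t g f = ip q t f g := by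
  have hm : ∀ a, ipForm q t g (monomial a 1) = coeff a g * pNorm q t a := fun a => by
    simpa [ipForm] using (basisMonomials ℕ+ K).constr_basis K
      (fun a => coeff a g * pNorm q t a) a
  conv_lhs => rw [f.as_sum, map_sum]
  refine Finset.sum_congr rfl fun a _ => ?_
  rw [show (monomial a (coeff a f) : Fock K) = coeff a f • monomial a 1 by simp [smul_monomial],
    map_smul, hm, smul_eq_mul, mul_assoc, pNorm]

theorem ip_comm (q t : K) (f g : Fock K) : ip q t f g = ip q t g f := by
  have h : ∀ f g : Fock K, ip q t f g =
      ∑ a ∈ f.support ∪ g.support, coeff a f * coeff a g * pNorm q t a := by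
    intro f g
    refine Finset.sum_subset Finset.subset_union_left fun a _ ha => ?_
    rw [notMem_support_iff.mp ha, zero_mul, zero_mul]
  rw [h, h, Finset.union_comm]
  exact Finset.sum_congr rfl fun a _ => by rw [mul_comm (coeff a f)]

theorem ip_smul_left (q t c : K) (f g : Fock K) : ip q t (c • f) g = c * ip q t f g := by
  rw [← ipForm_apply, map_smul, ipForm_apply, smul_eq_mul]

theorem ip_smul_right (q t c : K) (f g : Fock K) : ip q t f (c • g) = c * ip q t f g := by
  rw [ip_comm, ip_smul_left, ip_comm]

theorem rows_injective {n : ℕ} {mu lam : n.Partition} (h : rows mu = rows lam) : mu = lam := by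
  refine Nat.Partition.ext ?_
  rw [← Multiset.sort_eq mu.parts (· ≥ ·), ← Multiset.sort_eq lam.parts (· ≥ ·)]
  exact congrArg _ h

theorem DeltaH_apply (q t : K) (r : ℤ) {n : ℕ} {f : Fock K} (hf : f ∈ FockDeg K n) :
    DeltaH q t r f = ∑ lam : n.Partition,
      (ip q t f (macJ q t lam) / ip q t (macJ q t lam) (macJ q t lam) *
        hB q t (diagram lam) r) • macJ q t lam := by
  have hm : ∀ a : ℕ+ →₀ ℕ, DeltaH q t r (monomial a 1) =
      ∑ lam : (Finsupp.weight deg a).Partition,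
        (ip q t (monomial a 1) (macJ q t lam) / ip q t (macJ q t lam) (macJ q t lam) *
          hB q t (diagram lam) r) • macJ q t lam := fun a => by
    simpa [DeltaH] using (basisMonomials ℕ+ K).constr_basis K
      (fun a => ∑ lam : (Finsupp.weight deg a).Partition,
        (ip q t (monomial a 1) (macJ q t lam) / ip q t (macJ q t lam) (macJ q t lam) *
          hB q t (diagram lam) r) • macJ q t lam) a
  have hsum : ∀ g, ip q t f g = ∑ a ∈ f.support, coeff a f * ip q t (monomial a 1) g := by
    intro g
    rw [← ipForm_apply]
    conv_lhs => rw [f.as_sum, map_sum]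
    refine Finset.sum_congr rfl fun a _ => ?_
    rw [← ipForm_apply, ← smul_eq_mul, ← map_smul]
    simp [smul_monomial]
  simp_rw [hsum, Finset.sum_div, Finset.sum_mul, Finset.sum_smul]
  rw [Finset.sum_comm]
  conv_lhs => rw [f.as_sum, map_sum]
  refine Finset.sum_congr rfl fun a ha => ?_
  rw [show (monomial a (coeff a f) : Fock K) = coeff a f • monomial a 1 by simp [smul_monomial],
    map_smul, hm, hf (mem_support_iff.mp ha), Finset.smul_sum]
  refine Finset.sum_congr rfl fun lam _ => ?_
  rw [smul_smul, mul_div_assoc, mul_assoc]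

theorem macJ_homogeneous (q t : K) {n : ℕ} (lam : n.Partition) : macJ q t lam ∈ FockDeg K n :=
  Submodule.smul_mem _ _ (macP_homogeneous q t lam)

theorem hB_zero (q t : K) (Y : YoungDiagram) : hB q t Y 0 = 1 := by
  simp [hB, map_prod]

variable [Algebra ℚ K] {q t : K}

theorem ip_macP_of_mem_below (hind : AlgebraicIndependent ℚ ![q, t]) {n : ℕ}
    (lam : n.Partition) : ∀ mu ∈ below lam, ip q t (macP q t lam) (macP q t mu) = 0 := by
  induction h : (below lam).card using Nat.strong_induction_on generalizing lam with
  | _ N ih =>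
    intro mu hmu
    have hmac := macP_mem_ratPoly (left_mem_ratField q t) (right_mem_ratField q t) mu
    have horth : ∀ nu ∈ below lam, nu ≠ mu → ip q t (macP q t nu) (macP q t mu) = 0 := by
      intro nu hnu hne
      rcases lt_trichotomy (rows nu) (rows mu) with hlt | heq | hgt
      · rw [ip_comm]
        exact ih _ (h ▸ below_card_lt hmu) mu rfl nu
          (Finset.mem_filter.mpr ⟨Finset.mem_univ _, hlt⟩)
      · exact absurd (rows_injective heq) hne
      · exact ih _ (h ▸ below_card_lt hnu) nu rfl mu
          (Finset.mem_filter.mpr ⟨Finset.mem_univ _, hgt⟩)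
    rw [macP, ← ipForm_apply, map_sub, map_sum, Finset.sum_eq_single ⟨mu, hmu⟩]
    · simp only [map_smul, ipForm_apply, smul_eq_mul]
      by_cases h0 : macP q t mu = 0
      · rw [h0, ip_comm, ← ipForm_apply, map_zero, zero_div, zero_mul, sub_zero]
      · rw [div_mul_cancel₀ _ (ip_self_ne_zero hind hmac h0), sub_self]
    · intro nu _ hne
      rw [map_smul, ipForm_apply, horth nu.1 nu.2 fun e => hne (Subtype.ext e), smul_zero]
    · intro hmem
      exact absurd (Finset.mem_attach _ _) hmem

theorem ip_macJ_of_ne (hind : AlgebraicIndependent ℚ ![q, t]) {n : ℕ} {mu lam : n.Partition}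
    (hne : mu ≠ lam) : ip q t (macJ q t mu) (macJ q t lam) = 0 := by
  have : ip q t (macP q t mu) (macP q t lam) = 0 := by
    rcases lt_trichotomy (rows mu) (rows lam) with hlt | heq | hgt
    · rw [ip_comm]
      exact ip_macP_of_mem_below hind lam mu (Finset.mem_filter.mpr ⟨Finset.mem_univ _, hlt⟩)
    · exact absurd (rows_injective heq) hne
    · exact ip_macP_of_mem_below hind mu lam (Finset.mem_filter.mpr ⟨Finset.mem_univ _, hgt⟩)
  rw [macJ, macJ, ip_smul_left, ip_smul_right, this, mul_zero, mul_zero]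

theorem v_eq_DeltaH (hind : AlgebraicIndependent ℚ ![q, t]) (n : ℕ) (r : ℤ) :
    v q t n r = DeltaH q t r (v q t n 0) := by
  have hv : v q t n 0 ∈ FockDeg K n :=
    Submodule.sum_mem _ fun lam _ => Submodule.smul_mem _ _ (macJ_homogeneous q t lam)
  rw [DeltaH_apply q t r hv]
  refine Finset.sum_congr rfl fun lam _ => ?_
  by_cases h0 : macJ q t lam = 0
  · rw [h0, smul_zero, smul_zero]
  have hJ := ip_self_ne_zero hind
    (macJ_mem_ratPoly (left_mem_ratField q t) (right_mem_ratField q t) lam) h0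
  congr 2
  rw [← ipForm_apply, v, map_sum, Finset.sum_eq_single lam]
  · rw [map_smul, ipForm_apply, smul_eq_mul, hB_zero, mul_one, mul_div_cancel_right₀ _ hJ]
  · intro mu _ hne
    rw [map_smul, ipForm_apply, ip_macJ_of_ne hind hne, smul_zero]
  · intro h
    exact absurd (Finset.mem_univ _) h

end Orthogonality

/-! ### Specialization of the formal variable `u` -/

section Specialization

variable {K : Type*} [Field K]

/-- A sum of fractions `N_i / Q_i` vanishes in a ring that contains the polynomials and inverses
of the `Q_i` if and only if its numerator over the common denominator does. -/
theorem sum_mul_inv_eq_zero_iff {A R : Type*} [CommRing A] [CommRing R] {ε : A →+* R}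
    (hε : Function.Injective ε) {ι : Type*} [Fintype ι] [DecidableEq ι] (N Q : ι → A) (r : ι → R)
    (hr : ∀ i, ε (Q i) * r i = 1) :
    ∑ i, ε (N i) * r i = 0 ↔ ∑ i, N i * ∏ j ∈ Finset.univ.erase i, Q j = 0 := by
  have hu : IsUnit (∏ j, ε (Q j)) :=
    IsUnit.of_mul_eq_one (∏ j, r j) (by rw [← Finset.prod_mul_distrib]; simp [hr])
  have h : ε (∑ i, N i * ∏ j ∈ Finset.univ.erase i, Q j) =
      (∑ i, ε (N i) * r i) * ∏ j, ε (Q j) := by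
    rw [map_sum, Finset.sum_mul]
    refine Finset.sum_congr rfl fun i _ => ?_
    rw [map_mul, map_prod, ← Finset.mul_prod_erase Finset.univ _ (Finset.mem_univ i),
      show ε (N i) * r i * (ε (Q i) * ∏ j ∈ Finset.univ.erase i, ε (Q j)) =
        (ε (Q i) * r i) * (ε (N i) * ∏ j ∈ Finset.univ.erase i, ε (Q j)) by ring, hr, one_mul]
  rw [← map_eq_zero_iff ε hε, h, hu.mul_left_eq_zero]

/-- `∏_{b∈λ} (1 - u B_b)^{-1}` as a power series in `u`. -/
def hSeries (q t : K) (Y : YoungDiagram) : PowerSeries K :=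
  ∏ b ∈ Y.cells, (1 - PowerSeries.C (letter q t b) * PowerSeries.X : PowerSeries K)⁻¹

theorem hB_natCast (q t : K) (Y : YoungDiagram) (r : ℕ) :
    hB q t Y r = PowerSeries.coeff r (hSeries q t Y) := by
  rw [hB, if_neg (by omega), Int.toNat_natCast, hSeries]

theorem hB_of_neg (q t : K) (Y : YoungDiagram) {r : ℤ} (hr : r < 0) : hB q t Y r = 0 :=
  if_pos hr

/-- A linear relation between the products `∏_{b∈λ} (1 - u B_b)^{-1}` with coefficients in `F[u]`
holds at an element of `K` that is transcendental over `F` if and only if it holds formally. -/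
theorem sum_aeval_mul_eq_zero_iff {F : Subfield K} {q t u : K} (hq : q ∈ F) (ht : t ∈ F)
    (hu : Transcendental F u) {ι : Type*} [Fintype ι] (Y : ι → YoungDiagram)
    (N : ι → Polynomial F) :
    ∑ i, Polynomial.aeval u (N i) * ∏ b ∈ (Y i).cells, (1 - u * letter q t b)⁻¹ = 0 ↔
      ∑ i, (((N i).map F.subtype : Polynomial K) : PowerSeries K) * hSeries q t (Y i) = 0 := by
  classical
  let Q : ι → Polynomial F := fun i => ∏ b ∈ (Y i).cells,
    (1 - Polynomial.C ⟨letter q t b, letter_mem hq ht b⟩ * Polynomial.X)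
  have hfac : ∀ b, (1 - Polynomial.C (⟨letter q t b, letter_mem hq ht b⟩ : F) * Polynomial.X) ≠
      0 := by
    intro b h
    simpa using congrArg (Polynomial.eval 0) h
  have hinj : Function.Injective (Polynomial.aeval u : Polynomial F →ₐ[F] K) :=
    transcendental_iff_injective.mp hu
  let ε : Polynomial F →+* PowerSeries K :=
    Polynomial.coeToPowerSeries.ringHom.comp (Polynomial.mapRingHom F.subtype)
  have hε : Function.Injective ε :=
    (Polynomial.coe_injective K).comp (Polynomial.map_injective _ F.subtype_injective)
  refine (sum_mul_inv_eq_zero_iff (ε := (Polynomial.aeval u : Polynomial F →ₐ[F] K).toRingHom)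
    hinj N Q _ fun i => ?_).trans (sum_mul_inv_eq_zero_iff hε N Q _ fun i => ?_).symm
  · rw [map_prod, ← Finset.prod_mul_distrib]
    refine Finset.prod_eq_one fun b _ => ?_
    have h1 : Polynomial.aeval u
        (1 - Polynomial.C (⟨letter q t b, letter_mem hq ht b⟩ : F) * Polynomial.X) =
          1 - u * letter q t b := by
      rw [map_sub, map_one, map_mul, Polynomial.aeval_C, Polynomial.aeval_X, mul_comm]
      rfl
    have h2 : 1 - u * letter q t b ≠ 0 := by
      rw [← h1]
      exact fun h => hfac b (hinj (by rw [h, map_zero]))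
    exact (congrArg (· * _) h1).trans (mul_inv_cancel₀ h2)
  · rw [map_prod, hSeries, ← Finset.prod_mul_distrib]
    refine Finset.prod_eq_one fun b _ => ?_
    have h1 : ε (1 - Polynomial.C (⟨letter q t b, letter_mem hq ht b⟩ : F) * Polynomial.X) =
        1 - PowerSeries.C (letter q t b) * PowerSeries.X := by
      simp [ε]
    rw [h1]
    exact PowerSeries.mul_inv_cancel _ (by simp)

theorem coeff_map_vAt (q t u : K) (n : ℕ) (A : Module.End K (Fock K)) (a : ℕ+ →₀ ℕ) :
    coeff a (A (vAt q t u n)) = ∑ lam : n.Partition, vCoeff q t lam * coeff a (A (macJ q t lam)) *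
      ∏ b ∈ (diagram lam).cells, (1 - u * letter q t b)⁻¹ := by
  rw [vAt, map_sum, coeff_sum]
  refine Finset.sum_congr rfl fun lam _ => ?_
  rw [map_smul, coeff_smul, smul_eq_mul]
  ring

theorem coeff_map_v (q t : K) (n : ℕ) (r : ℤ) (A : Module.End K (Fock K)) (a : ℕ+ →₀ ℕ) :
    coeff a (A (v q t n r)) = ∑ lam : n.Partition,
      vCoeff q t lam * coeff a (A (macJ q t lam)) * hB q t (diagram lam) r := by
  rw [v, map_sum, coeff_sum]
  refine Finset.sum_congr rfl fun lam _ => ?_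
  rw [map_smul, coeff_smul, smul_eq_mul]
  ring

theorem v_of_neg (q t : K) (n : ℕ) {r : ℤ} (hr : r < 0) : v q t n r = 0 :=
  Finset.sum_eq_zero fun lam _ => by rw [hB_of_neg q t _ hr, mul_zero, zero_smul]

theorem coeff_uEtaD (q t : K) (d n r : ℕ) : PowerSeries.coeff r (uEtaD q t d n) =
    (q / t) ^ (d - 1) • eta q t d (v q t n ((r : ℤ) - 1)) + Dop q d (v q t n r) := by
  rw [uEtaD, map_add]
  congr 1
  · cases r with
    | zero => rw [PowerSeries.coeff_zero_X_mul, v_of_neg q t n (by simp), map_zero, smul_zero]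
    | succ r =>
      rw [PowerSeries.coeff_succ_X_mul, coeffwise, PowerSeries.coeff_mk, vSeries,
        PowerSeries.coeff_mk, LinearMap.smul_apply, Nat.cast_succ, add_sub_cancel_right]
  · rw [coeffwise, PowerSeries.coeff_mk, vSeries, PowerSeries.coeff_mk]

/-- The relation between the values `v_n(u)` at an element `u` transcendental over `F` is equivalent
to the formal one. For each monomial in the power sums it is a linear relation between the products
`∏_{b∈λ} (1 - u B_b)^{-1}` with coefficients in `F[u]`. -/
theorem eta_Dop_vAt_iff {F : Subfield K} {q t u : K} (hq : q ∈ F) (ht : t ∈ F)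
    (hu : Transcendental F u) (n d : ℕ) (P : Prop) [Decidable P] :
    (u * (q / t) ^ (d - 1)) • eta q t d (vAt q t u n) + Dop q d (vAt q t u n) =
        (if P then vAt q t u (n - 1) else 0) ↔
      uEtaD q t d n = if P then vSeries q t (n - 1) else 0 := by
  classical
  have hJ : ∀ {m : ℕ} (lam : m.Partition) {A : Module.End K (Fock K)} (_ : A ∈ ratEnd F)
      (a : ℕ+ →₀ ℕ), vCoeff q t lam * coeff a (A (macJ q t lam)) ∈ F := fun lam A hA a =>
    mul_mem (vCoeff_mem hq ht lam) (mem_ratPoly.mp (hA _ (macJ_mem_ratPoly hq ht lam)) a)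
  have hid : LinearMap.id ∈ ratEnd F := fun f hf => hf
  let α : (ℕ+ →₀ ℕ) → n.Partition → F := fun a lam =>
    ⟨_, mul_mem (pow_mem (div_mem hq ht) (d - 1)) (hJ lam (eta_mem_ratEnd hq ht d) a)⟩
  let β : (ℕ+ →₀ ℕ) → n.Partition → F := fun a lam => ⟨_, hJ lam (Dop_mem_ratEnd hq d) a⟩
  let γ : (ℕ+ →₀ ℕ) → (n - 1).Partition → F := fun a mu =>
    if P then ⟨_, hJ mu hid a⟩ else 0
  let N : (ℕ+ →₀ ℕ) → n.Partition ⊕ (n - 1).Partition → Polynomial F := fun a =>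
    Sum.elim (fun lam => Polynomial.X * Polynomial.C (α a lam) + Polynomial.C (β a lam))
      fun mu => -Polynomial.C (γ a mu)
  let Y : n.Partition ⊕ (n - 1).Partition → YoungDiagram := Sum.elim diagram diagram
  have key := fun a => sum_aeval_mul_eq_zero_iff hq ht hu Y (N a)
  have hγ : ∀ a mu, (γ a mu : K) =
      if P then vCoeff q t mu * coeff a (macJ q t mu) else 0 := by
    intro a mu
    by_cases hP : P <;> simp [γ, hP]
  rw [MvPolynomial.ext_iff, PowerSeries.ext_iff]
  refine Iff.trans (Iff.trans ?_ forall_comm) (forall_congr' fun r => MvPolynomial.ext_iff).symm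
  refine forall_congr' fun a => ?_
  rw [← sub_eq_zero]
  refine Iff.trans (iff_of_eq (congrArg (· = 0) ?_)) ((key a).trans ?_)
  · rw [Fintype.sum_sum_type, sub_eq_add_neg, coeff_add, coeff_smul]
    congr 1
    · rw [coeff_map_vAt, coeff_map_vAt, smul_eq_mul, Finset.mul_sum, ← Finset.sum_add_distrib]
      refine Finset.sum_congr rfl fun lam _ => ?_
      simp only [N, Y, Sum.elim_inl, map_add, map_mul, Polynomial.aeval_X, Polynomial.aeval_C]
      change _ = (u * ((q / t) ^ (d - 1) * (vCoeff q t lam * coeff a (eta q t d (macJ q t lam)))) +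
        vCoeff q t lam * coeff a (Dop q d (macJ q t lam))) * _
      ring
    · have h := coeff_map_vAt q t u (n - 1) LinearMap.id a
      simp only [LinearMap.id_apply] at h
      simp only [N, Y, Sum.elim_inr, map_neg, Polynomial.aeval_C, neg_mul, Finset.sum_neg_distrib]
      congr 1
      change _ = ∑ mu, (γ a mu : K) * _
      simp_rw [hγ]
      by_cases hP : P
      · simp only [if_pos hP]
        exact h
      · simp only [if_neg hP]
        simp
  · rw [PowerSeries.ext_iff]
    refine forall_congr' fun r => ?_
    rw [← sub_eq_zero (a := coeff a _), map_zero]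
    refine iff_of_eq (congrArg (· = 0) ?_)
    rw [Fintype.sum_sum_type, map_add, map_sum, map_sum, sub_eq_add_neg, coeff_uEtaD, coeff_add,
      coeff_smul, coeff_map_v, coeff_map_v, smul_eq_mul, Finset.mul_sum, ← Finset.sum_add_distrib]
    congr 1
    · refine Finset.sum_congr rfl fun lam _ => ?_
      simp only [N, Y, Sum.elim_inl, Polynomial.map_add, Polynomial.map_mul, Polynomial.map_X,
        Polynomial.map_C, Polynomial.coe_add, Polynomial.coe_mul, Polynomial.coe_X,
        Polynomial.coe_C, add_mul, map_add, mul_assoc, PowerSeries.coeff_C_mul]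
      rw [hB_natCast]
      congr 1
      · cases r with
        | zero =>
          rw [PowerSeries.coeff_zero_X_mul, hB_of_neg q t _ (by simp)]
          simp
        | succ r =>
          rw [PowerSeries.coeff_succ_X_mul, PowerSeries.coeff_C_mul, Nat.cast_succ,
            add_sub_cancel_right, hB_natCast]
          change (q / t) ^ (d - 1) *
            (vCoeff q t lam * coeff a (eta q t d (macJ q t lam))) * _ = _
          ring
      · change vCoeff q t lam * coeff a (Dop q d (macJ q t lam)) * _ = _
        ring
    · have h := coeff_map_v q t (n - 1) r LinearMap.id a
      simp only [LinearMap.id_apply] at h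
      simp only [N, Y, Sum.elim_inr, Polynomial.map_neg, Polynomial.map_C, Polynomial.coe_neg,
        Polynomial.coe_C, neg_mul, map_neg, Finset.sum_neg_distrib, PowerSeries.coeff_C_mul]
      congr 1
      change ∑ mu, (γ a mu : K) * _ = _
      simp_rw [hγ, ← hB_natCast]
      by_cases hP : P
      · simp only [if_pos hP, vSeries, PowerSeries.coeff_mk]
        exact h.symm
      · simp only [if_neg hP]
        simp

end Specialization

/-! ### Consequences of algebraic independence -/

section Independence

variable {K : Type*} [Field K] [Algebra ℚ K] {q t k : K}

theorem algebraicIndependent_pair (hind : AlgebraicIndependent ℚ ![q, t, k]) :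
    AlgebraicIndependent ℚ ![q, t] := by
  have := hind.comp Fin.castSucc (Fin.castSucc_injective 2)
  convert this using 1
  funext i
  fin_cases i <;> rfl

theorem one_add_div_pow_ne_zero (hind : AlgebraicIndependent ℚ ![q, t]) (n : ℕ) :
    1 + (q / t) ^ n ≠ 0 := by
  have ht : t ≠ 0 := hind.ne_zero 1
  intro h
  have h1 : aeval ![q, t] (X 1 ^ n + X 0 ^ n : MvPolynomial (Fin 2) ℚ) = 0 := by
    rw [div_pow] at h
    field_simp at h
    simpa using h
  have h2 : (X 1 ^ n + X 0 ^ n : MvPolynomial (Fin 2) ℚ) = 0 :=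
    hind (by rw [h1, map_zero])
  have h3 := congrArg (eval fun _ => (1 : ℚ)) h2
  norm_num at h3

open scoped IntermediateField.algebraAdjoinAdjoin in
theorem transcendental_ratField (hind : AlgebraicIndependent ℚ ![q, t, k]) :
    Transcendental (ratField q t) k := by
  have h := hind.transcendental_adjoin (s := {0, 1}) (i := 2) (by decide)
  have hset : ![q, t, k] '' {0, 1} = Set.range ![q, t] := by
    ext x
    simp [Set.image_pair, eq_comm, or_comm]
  rw [hset] at h
  exact h.extendScalars (IntermediateField.adjoin ℚ (Set.range ![q, t]))

/-- The specialization `u = k² q / t` is generic. -/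
theorem transcendental_sq_mul_div (hind : AlgebraicIndependent ℚ ![q, t, k]) :
    Transcendental (ratField q t) (k ^ 2 * q / t) := by
  have hq : q ≠ 0 := hind.ne_zero 0
  have ht : t ≠ 0 := hind.ne_zero 1
  intro h
  refine transcendental_ratField hind (IsAlgebraic.of_pow two_pos ?_)
  have hc : IsAlgebraic (ratField q t) (t / q) := isAlgebraic_algebraMap
    (⟨t / q, div_mem (right_mem_ratField q t) (left_mem_ratField q t)⟩ : ratField q t)
  have := h.mul hc
  rwa [show k ^ 2 * q / t * (t / q) = k ^ 2 by field_simp] at this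

end Independence

end Whittaker

end

open Whittaker in
theorem proposition3p2 {K : Type*} [Field K] [Algebra ℚ K] (q t s k L : K)
    (hind : AlgebraicIndependent ℚ ![q, t, k]) (hs : s ^ 2 = q / t) (hL : L ≠ 0) :
    (∀ (n : ℕ) (r : ℤ), v q t n r = DeltaH q t r (v q t n 0)) ∧
    List.TFAE [
      -- the Whittaker condition `T_1 v_G = L v_G`, `T_d v_G = 0` for `d ≥ 2`
      IsWhittaker q t s k L (vG q t s k L),
      -- the condition on the formal series `v_n(u)`, with `v_{-1}(u) = 0`
      ∀ n d : ℕ, 1 ≤ d →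
        uEtaD q t d n = if d = 1 ∧ 1 ≤ n then vSeries q t (n - 1) else 0,
      -- its form for `d ≥ 2` split by powers of `u`
      ∀ n : ℕ, uEtaD q t 1 (n + 1) = vSeries q t n ∧
        ∀ (d r : ℕ), 2 ≤ d →
          (q / t) ^ (d - 1) • eta q t d (v q t n ((r : ℤ) - 1)) + Dop q d (v q t n r) = 0,
      -- the three conditions in terms of `Δ_{h_r}`
      ∀ n : ℕ, uEtaD q t 1 (n + 1) = vSeries q t n ∧
        (∀ d : ℕ, 2 ≤ d → Dop q d (v q t n 0) = 0) ∧
        ∀ (d r : ℕ), 2 ≤ d →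
          (q / t) ^ (d - 1) • eta q t d (DeltaH q t ((r : ℤ) - 1) (v q t n 0))
            + Dop q d (DeltaH q t r (v q t n 0)) = 0] := by
  have : CharZero K := algebraRat.charZero K
  have hind2 := algebraicIndependent_pair hind
  have hq : q ≠ 0 := hind.ne_zero 0
  have ht : t ≠ 0 := hind.ne_zero 1
  have hk : k ≠ 0 := hind.ne_zero 2
  have hs0 : s ≠ 0 := by
    rintro rfl
    exact div_ne_zero hq ht (by rw [← hs, zero_pow two_ne_zero])
  have hv := v_eq_DeltaH (K := K) hind2
  refine ⟨hv, ?_⟩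
  tfae_have 1 ↔ 2 := by
    rw [isWhittaker_vG_iff hs0 hk hL hs fun n _ => one_add_div_pow_ne_zero hind2 n]
    exact forall_congr' fun n => forall_congr' fun d => forall_congr' fun _ =>
      eta_Dop_vAt_iff (left_mem_ratField q t) (right_mem_ratField q t)
        (transcendental_sq_mul_div hind) n d _
  tfae_have 2 ↔ 3 := by
    constructor
    · intro h n
      refine ⟨by simpa using h (n + 1) 1 le_rfl, fun d r hd => ?_⟩
      rw [← coeff_uEtaD, h n d (by omega), if_neg (by omega), map_zero]
    · intro h n d hd
      rcases eq_or_lt_of_le hd with rfl | hd2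
      · cases n with
        | zero =>
          -- Operators that lower the degree annihilate degree `0`.
          rw [if_neg (by omega)]
          ext1 r
          have h0 : ∀ r, v q t 0 r ∈ FockDeg K 0 := fun r => Submodule.sum_mem _ fun lam _ =>
            Submodule.smul_mem _ _ (macJ_homogeneous q t lam)
          rw [coeff_uEtaD, (eta_mem_lowering q t 1 0 _ (h0 _)).1 one_pos,
            (Dop_mem_lowering q 1 0 _ (h0 _)).1 one_pos, smul_zero, add_zero, map_zero]
        | succ n => rw [(h n).1, if_pos ⟨rfl, by omega⟩, Nat.add_sub_cancel]
      · rw [if_neg (by omega)]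
        ext1 r
        rw [coeff_uEtaD, (h n).2 d r hd2, map_zero]
  tfae_have 3 ↔ 4 := by
    refine forall_congr' fun n => and_congr_right fun _ => ?_
    simp_rw [← hv]
    refine ⟨fun h => ⟨fun d hd => ?_, h⟩, fun h => h.2⟩
    have := h d 0 hd
    rwa [v_of_neg q t n (by simp), map_zero, smul_zero, zero_add] at this
  tfae_finish
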